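/- Let $d\ge 2$ and let $X_1,X_2,\dots$ be i.i.d. $\mathbb{R}^d$-valued random vectors with a spherically symmetric distribution that has a density function $f$ such that, as $|x|\to\infty$, $$f(x)\sim c\,|x|^{\alpha}e^{-\beta|x|^{\gamma}}$$ for some constants $c,\beta,\gamma>0$ and $\alpha\in\mathbb{R}$, where $|\cdot|$ is the Euclidean norm. Let $MM_n=\max_{1\le i<j\le n}|X_i-X_j|$ be the maximum interpoint distance. Then, as $n\to\infty$, $$\beta^{1/\gamma}\gamma(\log n)^{1-1/\gamma}\cdot MM_n-\Bigl(2\gamma\log n+\Bigl(2\,\frac{\alpha+d}{\gamma}-\frac{d+3}{2}\Bigr)\log\log n+\log\log\log n+\log\bigl(c'_d\,\beta^{-2(\alpha+d)/\gamma}\gamma^{-(d+3)/2}c^2\bigr)\Bigr)\xrightarrow{\;d\;}V,$$ where $$c'_d=\frac{(d-1)\,2^{d-2}\,\pi^{d-1/2}}{\Gamma(d/2)}$$ and $V$ has the Gumbel distribution, $\mathbb{P}(V\le x)=\exp(-e^{-x})$ for $x\in\mathbb{R}$. -/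

import Mathlib

open MeasureTheory ProbabilityTheory Filter Topology Asymptotics

/-- The Gumbel distribution function `x ↦ exp (-exp (-x))`, as a Stieltjes function. -/
noncomputable def gumbelCDF : StieltjesFunction ℝ where
  toFun x := Real.exp (-Real.exp (-x))
  mono' := fun x y hxy => by
    apply Real.exp_le_exp.mpr
    apply neg_le_neg
    exact Real.exp_le_exp.mpr (neg_le_neg hxy)
  right_continuous' := fun x => by
    have h : Continuous fun x : ℝ => Real.exp (-Real.exp (-x)) := by fun_prop
    exact h.continuousWithinAt

/-- The Gumbel distribution: the measure on `ℝ` with distribution function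
`x ↦ exp (-exp (-x))`. -/
noncomputable def gumbelMeasure : Measure ℝ := gumbelCDF.measure

instance instIsProbabilityMeasureGumbelMeasure : IsProbabilityMeasure gumbelMeasure := by
  refine StieltjesFunction.isProbabilityMeasure gumbelCDF ?_ ?_
  · change Tendsto (fun x : ℝ => Real.exp (-Real.exp (-x))) atBot (𝓝 0)
    exact Real.tendsto_exp_atBot.comp
      (tendsto_neg_atTop_atBot.comp (Real.tendsto_exp_atTop.comp tendsto_neg_atBot_atTop))
  · change Tendsto (fun x : ℝ => Real.exp (-Real.exp (-x))) atTop (𝓝 1)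
    have h1 : Tendsto (fun x : ℝ => -Real.exp (-x)) atTop (𝓝 (-0)) :=
      (Real.tendsto_exp_atBot.comp tendsto_neg_atTop_atBot).neg
    have h2 := (Real.continuous_exp.tendsto (-0)).comp h1
    simpa [Function.comp_def] using h2

/-- A measure on a real inner product space is spherically symmetric if it is invariant under
all linear isometries of the space onto itself. -/
def IsSphericallySymmetric {E : Type*} [NormedAddCommGroup E] [InnerProductSpace ℝ E]
    [MeasurableSpace E] (ν : Measure E) : Prop :=
  ∀ O : E ≃ₗᵢ[ℝ] E, ν.map O = ν

/-- The maximum interpoint distance `max_{i < j < n} |x i - x j|` of the first `n` points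
of a sequence (it is `0` if `n < 2`, when there are no such pairs). -/
noncomputable def maxInterpointDist {E : Type*} [NormedAddCommGroup E]
    (x : ℕ → E) (n : ℕ) : ℝ :=
  ⨆ p : {p : Fin n × Fin n // p.1 < p.2}, ‖x p.1.1 - x p.1.2‖

/-- The constant `c'_d = (d-1) 2^(d-2) π^(d-1/2) / Γ(d/2)`. -/
noncomputable def interpointConst (d : ℕ) : ℝ :=
  ((d : ℝ) - 1) * (2 : ℝ) ^ ((d : ℝ) - 2) * Real.pi ^ ((d : ℝ) - 1 / 2) / Real.Gamma ((d : ℝ) / 2)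

/-- The scaling factor `β^(1/γ) γ (log n)^(1-1/γ)`. -/
noncomputable def interpointScale (β γ : ℝ) (n : ℕ) : ℝ :=
  β ^ (1 / γ) * γ * Real.log n ^ (1 - 1 / γ)

/-- The centring
`2 γ log n + (2 (α+d)/γ - (d+3)/2) log log n + log log log n`
`+ log (c'_d β^(-2 (α+d)/γ) γ^(-(d+3)/2) c^2)`. -/
noncomputable def interpointCentring (d : ℕ) (c α β γ : ℝ) (n : ℕ) : ℝ :=
  2 * γ * Real.log n
    + (2 * ((α + d) / γ) - ((d : ℝ) + 3) / 2) * Real.log (Real.log n)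
    + Real.log (Real.log (Real.log n))
    + Real.log (interpointConst d * β ^ (-(2 * (α + d) / γ)) * γ ^ (-(((d : ℝ) + 3) / 2)) * c ^ 2)

/-!
Put `d = k + 1` and `N = log n`, let `b = (N / β)^{1/γ}` be the radius near which the extreme
points lie, and measure lengths in units of `δ = b / (γ N)`, the reciprocal of the scaling factor.
The expected number of sample points with `|x| = b + δ u` has a density in `u` proportional to
`D e^{-u}`, for an explicit `D = D(N)`. Two points at distances `b + δ u` and `b + δ v` from the
origin are at distance more than `2 b + δ T` exactly if the angle between the first and the
opposite of the second is small, of order `√((u + v - T) / N)`; this has probability of order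
`((u + v - T)⁺ / N)^{(d-1)/2}`. Hence the expected number of such pairs is asymptotic to a constant
times `D² e^{-T} N^{-(d-1)/2}` times the length of the range in which `u` may vary given `u + v`.

That range has to be restricted: with high probability no sample point lies beyond
`u = log D + o(log log n)`, and more extreme points, although they hardly ever occur, would dominate
the expectation. Therefore points are discarded beyond the truncation level
`K = log D + ½ log log log n` (`PairScaling.cutoffLevel`). The probability that any sample point is
discarded tends to zero (`PairScaling.tendsto_tail`). The range that remains has length
`2 K - T ~ ((d-1)/2) log log n`, which is the source of the triple logarithm in the centring. If `T`
corresponds to the value `t` of the normalized maximum, the expected number of remaining pairs tends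
to `e^{-t}` (`PairScaling.tendsto_farPairs`, `PairScaling.unitSphereArea_mul_pairConst`). After
truncation every single point has only `o(1)` far neighbours in expectation
(`PairScaling.exists_tendsto_slice`), so that the pairs hardly cluster, and the probability that
there are none tends to `exp (-e^{-t})` (`tendsto_measureReal_noPairEvent`).

The Poisson limit is proved by adding the points one at a time: up to negligible errors, the
probability of no related pairs is multiplied by `1 - j p` when a point is added to `j` others,
where `p` is the probability that two given points are related
(`abs_measureReal_noPairEvent_succ_le`). The expected number of pairs is found from two-sided bounds
by an exactly solvable model (`measure_farPairs_bounds`), which need the measure of a spherical cap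
(`toSphere_cap_bounds`) and the local expansions of the density and of the distance
(`exists_abs_rpow_mul_exp_sub_one_le`, `exists_toSphere_far_bounds`).
-/

/-! ### Convergence in distribution through distribution functions -/

/-- Convergence in distribution of real random variables follows from pointwise convergence of the
distribution functions: half-open intervals form a `π`-system with small neighbourhoods. -/
theorem tendstoInDistribution_of_tendsto_measureReal_le {Ω Ω' : Type*} [MeasurableSpace Ω]
    [MeasurableSpace Ω'] {P : Measure Ω} [IsProbabilityMeasure P] {P' : Measure Ω'}
    [IsProbabilityMeasure P'] {Y : ℕ → Ω → ℝ} {V : Ω' → ℝ} (hY : ∀ n, Measurable (Y n))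
    (hV : AEMeasurable V P')
    (h : ∀ t, Tendsto (fun n => P.real {ω | Y n ω ≤ t}) atTop (𝓝 ((P'.map V).real (Set.Iic t)))) :
    TendstoInDistribution Y atTop V (fun _ => P) P' := by
  refine ⟨fun n => (hY n).aemeasurable, hV, ?_⟩
  have hprob : IsProbabilityMeasure (P'.map V) := Measure.isProbabilityMeasure_map hV
  have hπ := isPiSystem_Ioc_mem (Set.univ : Set ℝ) Set.univ
  refine hπ.tendsto_probabilityMeasure_of_tendsto_of_mem ?_ ?_ ?_
  · rintro s ⟨a, -, b, -, -, rfl⟩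
    exact measurableSet_Ioc
  · intro u hu x hx
    obtain ⟨ε, hε, hball⟩ := Metric.isOpen_iff.1 hu x hx
    refine ⟨Set.Ioc (x - ε / 2) (x + ε / 2), ⟨_, trivial, _, trivial, by linarith, rfl⟩,
      Ioc_mem_nhds (by linarith) (by linarith), fun y hy => hball ?_⟩
    rw [Metric.mem_ball, Real.dist_eq, abs_lt]
    constructor <;> linarith [hy.1, hy.2]
  · rintro s ⟨a, -, b, -, hab, rfl⟩
    rw [← NNReal.tendsto_coe]
    have key : ∀ ν : Measure ℝ, IsProbabilityMeasure ν →
        ν.real (Set.Ioc a b) = ν.real (Set.Iic b) - ν.real (Set.Iic a) := by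
      intro ν _
      rw [show Set.Ioc a b = Set.Iic b \ Set.Iic a by ext y; simp [and_comm],
        measureReal_sdiff (Set.Iic_subset_Iic.2 hab.le) measurableSet_Iic]
    have h1 := (h b).sub (h a)
    rw [← key _ hprob] at h1
    refine h1.congr fun n => ?_
    have hn : IsProbabilityMeasure (P.map (Y n)) :=
      Measure.isProbabilityMeasure_map (hY n).aemeasurable
    have h2 := key (P.map (Y n)) hn
    rw [map_measureReal_apply (hY n) measurableSet_Iic,
      map_measureReal_apply (hY n) measurableSet_Iic] at h2
    exact h2.symm

/-! ### Poisson approximation for the absence of related pairs -/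

section RelatedPairs

variable {Ω E : Type*}

/-- The event that no two of the points `X i`, `i ∈ S`, are related by `H`. -/
def noPairEvent (X : ℕ → Ω → E) (H : Set (E × E)) (S : Finset ℕ) : Set Ω :=
  {ω | ∀ i ∈ S, ∀ j ∈ S, i ≠ j → (X i ω, X j ω) ∉ H}

theorem noPairEvent_anti (X : ℕ → Ω → E) (H : Set (E × E)) {S S' : Finset ℕ} (h : S ⊆ S') :
    noPairEvent X H S' ⊆ noPairEvent X H S :=
  fun _ hω i hi j hj hij => hω i (h hi) j (h hj) hij

variable [MeasurableSpace Ω] [MeasurableSpace E]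

theorem measurableSet_noPairEvent {X : ℕ → Ω → E} (hX : ∀ i, Measurable (X i)) {H : Set (E × E)}
    (hH : MeasurableSet H) (S : Finset ℕ) : MeasurableSet (noPairEvent X H S) := by
  have : noPairEvent X H S = ⋂ i ∈ S, ⋂ j ∈ S, ⋂ (_ : i ≠ j),
      ((fun ω => (X i ω, X j ω)) ⁻¹' H)ᶜ := by
    ext ω; simp [noPairEvent]
  rw [this]
  exact Finset.measurableSet_biInter _ fun i _ => Finset.measurableSet_biInter _ fun j _ =>
    MeasurableSet.iInter fun _ => (((hX i).prodMk (hX j)) hH).compl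

variable {P : Measure Ω} [IsProbabilityMeasure P] {μ : Measure E}
  {X : ℕ → Ω → E} {H : Set (E × E)}

theorem measureReal_pair (hX : ∀ i, Measurable (X i)) (hind : iIndepFun X P)
    (hlaw : ∀ i, P.map (X i) = μ) (hH : MeasurableSet H) {i k : ℕ} (hik : i ≠ k) :
    P.real {ω | (X i ω, X k ω) ∈ H} = (μ.prod μ).real H := by
  have h := (indepFun_iff_map_prod_eq_prod_map_map (hX i).aemeasurable (hX k).aemeasurable).1
    (hind.indepFun hik)
  rw [hlaw, hlaw] at h
  rw [← h, map_measureReal_apply ((hX i).prodMk (hX k)) hH]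
  rfl

/-- Two points outside `S` are independent of the configuration of the points in `S`. -/
theorem measureReal_noPairEvent_inter_pair (hX : ∀ i, Measurable (X i)) (hind : iIndepFun X P)
    (hlaw : ∀ i, P.map (X i) = μ) (hH : MeasurableSet H) {S : Finset ℕ} {i k : ℕ}
    (hi : i ∉ S) (hk : k ∉ S) (hik : i ≠ k) :
    P.real (noPairEvent X H S ∩ {ω | (X i ω, X k ω) ∈ H}) =
      P.real (noPairEvent X H S) * (μ.prod μ).real H := by
  have hdisj : Disjoint S {i, k} := by
    simp only [Finset.disjoint_left, Finset.mem_insert, Finset.mem_singleton]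
    rintro a ha (rfl | rfl)
    exacts [hi ha, hk ha]
  have h := hind.indepFun_finset S {i, k} hdisj hX
  let A : Set (S → E) := ⋂ a : S, ⋂ b : S, ⋂ (_ : a ≠ b), ((fun x => (x a, x b)) ⁻¹' H)ᶜ
  let ii : ({i, k} : Finset ℕ) := ⟨i, by simp⟩
  let kk : ({i, k} : Finset ℕ) := ⟨k, by simp⟩
  let B : Set (({i, k} : Finset ℕ) → E) := (fun x => (x ii, x kk)) ⁻¹' H
  have hA : MeasurableSet A := MeasurableSet.iInter fun a => MeasurableSet.iInter fun b =>
    MeasurableSet.iInter fun _ =>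
      (((measurable_pi_apply a).prodMk (measurable_pi_apply b)) hH).compl
  have hB : MeasurableSet B := ((measurable_pi_apply ii).prodMk (measurable_pi_apply kk)) hH
  have h1 := h.measure_inter_preimage_eq_mul _ _ hA hB
  have e1 : (fun ω (a : S) => X a ω) ⁻¹' A = noPairEvent X H S := by
    ext ω
    simp only [A, Set.mem_preimage, Set.mem_iInter, Set.mem_compl_iff, noPairEvent,
      Set.mem_ofPred_eq]
    constructor
    · intro h a ha b hb hab
      exact h ⟨a, ha⟩ ⟨b, hb⟩ (fun hh => hab (congrArg Subtype.val hh))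
    · intro h a b hab
      exact h a a.2 b b.2 (fun hh => hab (Subtype.ext hh))
  have e2 : (fun ω (a : ({i, k} : Finset ℕ)) => X a ω) ⁻¹' B = {ω | (X i ω, X k ω) ∈ H} := rfl
  rw [e1, e2] at h1
  rw [← measureReal_pair hX hind hlaw hH hik, Measure.real, h1, ENNReal.toReal_mul]
  rfl

/-- Deleting one point from the configuration changes the probability that there are no related
pairs by at most the sum of the probabilities of the pairs containing that point. -/
theorem measureReal_noPairEvent_erase_le (hX : ∀ i, Measurable (X i)) (hind : iIndepFun X P)
    (hlaw : ∀ i, P.map (X i) = μ) (hH : MeasurableSet H) (hsymm : ∀ x y, (x, y) ∈ H → (y, x) ∈ H)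
    {S : Finset ℕ} {i : ℕ} :
    P.real (noPairEvent X H (S.erase i)) ≤
      P.real (noPairEvent X H S) + S.card * (μ.prod μ).real H := by
  have hsub : noPairEvent X H (S.erase i) ⊆
      noPairEvent X H S ∪ ⋃ j ∈ S.erase i, {ω | (X i ω, X j ω) ∈ H} := by
    intro ω hω
    by_contra hcon
    simp only [Set.mem_union, Set.mem_iUnion, not_or, not_exists] at hcon
    refine hcon.1 fun a ha b hb hab => ?_
    by_cases hai : a = i
    · subst hai
      exact hcon.2 b (Finset.mem_erase.2 ⟨hab.symm, hb⟩)
    by_cases hbi : b = i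
    · subst hbi
      exact fun h => hcon.2 a (Finset.mem_erase.2 ⟨hab, ha⟩) (hsymm _ _ h)
    exact hω a (Finset.mem_erase.2 ⟨hai, ha⟩) b (Finset.mem_erase.2 ⟨hbi, hb⟩) hab
  refine (measureReal_mono hsub).trans ((measureReal_union_le _ _).trans ?_)
  gcongr
  refine (measureReal_biUnion_finset_le _ _).trans ?_
  calc ∑ j ∈ S.erase i, P.real {ω | (X i ω, X j ω) ∈ H}
      = ∑ j ∈ S.erase i, (μ.prod μ).real H := Finset.sum_congr rfl fun j hj =>
        measureReal_pair hX hind hlaw hH (Finset.ne_of_mem_erase hj).symm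
    _ ≤ S.card * (μ.prod μ).real H := by
        rw [Finset.sum_const, nsmul_eq_mul]
        gcongr
        exact Finset.erase_subset _ _

variable [IsProbabilityMeasure μ]

/-- If every point is related to a random one with probability at most `Q`, two prescribed pairs
with a common point are both related with probability at most `Q` times that of one pair. -/
theorem measureReal_two_pairs_le (hX : ∀ i, Measurable (X i)) (hind : iIndepFun X P)
    (hlaw : ∀ i, P.map (X i) = μ) (hH : MeasurableSet H) {Q : ℝ}
    (hQ : ∀ x, μ.real {y | (x, y) ∈ H} ≤ Q) {i j k : ℕ} (hik : i ≠ k) (hij : i ≠ j) (hkj : k ≠ j) :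
    P.real {ω | (X i ω, X k ω) ∈ H ∧ (X k ω, X j ω) ∈ H} ≤ Q * (μ.prod μ).real H := by
  have h1 := (indepFun_iff_map_prod_eq_prod_map_map ((hX i).prodMk (hX k)).aemeasurable
    (hX j).aemeasurable).1 (hind.indepFun_prodMk hX i k j hij hkj)
  have h2 := (indepFun_iff_map_prod_eq_prod_map_map (hX i).aemeasurable (hX k).aemeasurable).1
    (hind.indepFun hik)
  rw [hlaw, hlaw] at h2
  rw [h2, hlaw] at h1
  let W : Set ((E × E) × E) := {z | z.1 ∈ H ∧ (z.1.2, z.2) ∈ H}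
  have hW : MeasurableSet W := (measurable_fst hH).inter
    (((measurable_snd.comp measurable_fst).prodMk measurable_snd) hH)
  have h3 : P {ω | (X i ω, X k ω) ∈ H ∧ (X k ω, X j ω) ∈ H} = ((μ.prod μ).prod μ) W := by
    rw [← h1, Measure.map_apply (((hX i).prodMk (hX k)).prodMk (hX j)) hW]
    rfl
  have hQ0 : 0 ≤ Q := by
    obtain ⟨x⟩ : Nonempty E := nonempty_of_isProbabilityMeasure μ
    exact measureReal_nonneg.trans (hQ x)
  have h4 : ((μ.prod μ).prod μ) W ≤ ENNReal.ofReal Q * (μ.prod μ) H := by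
    rw [Measure.prod_apply hW]
    calc ∫⁻ z, μ (Prod.mk z ⁻¹' W) ∂(μ.prod μ)
        ≤ ∫⁻ z, H.indicator (fun _ => ENNReal.ofReal Q) z ∂(μ.prod μ) := by
          refine lintegral_mono fun z => ?_
          by_cases hz : z ∈ H
          · rw [Set.indicator_of_mem hz]
            refine (measure_mono (t := {y | (z.2, y) ∈ H}) fun y hy => hy.2).trans ?_
            rw [← ofReal_measureReal]
            exact ENNReal.ofReal_le_ofReal (hQ _)
          · have : Prod.mk z ⁻¹' W = ∅ := by
              ext y; simp [W, hz]
            simp [this]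
      _ = ENNReal.ofReal Q * (μ.prod μ) H := by
          rw [lintegral_indicator_const hH]
  rw [Measure.real, h3]
  refine (ENNReal.toReal_mono (by finiteness) h4).trans ?_
  rw [ENNReal.toReal_mul, ENNReal.toReal_ofReal hQ0]
  rfl

theorem measureReal_prod_le (hH : MeasurableSet H) {Q : ℝ}
    (hQ : ∀ x, μ.real {y | (x, y) ∈ H} ≤ Q) : (μ.prod μ).real H ≤ Q := by
  have hQ0 : 0 ≤ Q := by
    obtain ⟨x⟩ : Nonempty E := nonempty_of_isProbabilityMeasure μ
    exact measureReal_nonneg.trans (hQ x)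
  have : (μ.prod μ) H ≤ ENNReal.ofReal Q := by
    rw [Measure.prod_apply hH]
    calc ∫⁻ x, μ (Prod.mk x ⁻¹' H) ∂μ ≤ ∫⁻ _, ENNReal.ofReal Q ∂μ := by
          refine lintegral_mono fun x => ?_
          rw [← ofReal_measureReal]
          exact ENNReal.ofReal_le_ofReal (hQ x)
      _ = ENNReal.ofReal Q := by simp
  exact ENNReal.toReal_le_of_le_ofReal hQ0 this

/-- One step of the recursion for the probability that there are no related pairs among the first
`k` points. -/
theorem abs_measureReal_noPairEvent_succ_le (hX : ∀ i, Measurable (X i)) (hind : iIndepFun X P)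
    (hlaw : ∀ i, P.map (X i) = μ) (hH : MeasurableSet H) (hsymm : ∀ x y, (x, y) ∈ H → (y, x) ∈ H)
    {Q : ℝ} (hQ : ∀ x, μ.real {y | (x, y) ∈ H} ≤ Q) (k : ℕ) :
    |P.real (noPairEvent X H (Finset.range (k + 1))) -
        (1 - k * (μ.prod μ).real H) * P.real (noPairEvent X H (Finset.range k))| ≤
      2 * (k : ℝ) ^ 2 * (Q * (μ.prod μ).real H) := by
  set p := (μ.prod μ).real H with hp
  have hp0 : 0 ≤ p := measureReal_nonneg
  have hpQ : p ≤ Q := measureReal_prod_le hH hQ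
  set R := Finset.range k with hR
  set A := noPairEvent X H R with hA
  set A' := noPairEvent X H (Finset.range (k + 1)) with hA'
  let B : ℕ → Set Ω := fun i => {ω | (X i ω, X k ω) ∈ H}
  have hAm : MeasurableSet A := measurableSet_noPairEvent hX hH _
  have hA'm : MeasurableSet A' := measurableSet_noPairEvent hX hH _
  have hBm : ∀ i j, MeasurableSet {ω | (X i ω, X j ω) ∈ H} :=
    fun i j => ((hX i).prodMk (hX j)) hH
  have hsub : A' ⊆ A := noPairEvent_anti X H (Finset.range_subset_range.2 (Nat.le_succ k))
  have hkR : k ∉ R := by simp [hR]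
  have hdiff : A \ A' = A ∩ ⋃ i ∈ R, B i := by
    ext ω
    simp only [Set.mem_sdiff, Set.mem_inter_iff, Set.mem_iUnion, exists_prop]
    refine and_congr_right fun hω => ⟨fun h => ?_, fun ⟨i, hi, h⟩ h' => ?_⟩
    · by_contra hcon
      push Not at hcon
      refine h fun a ha b hb hab => ?_
      rw [Finset.range_add_one, Finset.mem_insert] at ha hb
      rcases ha with rfl | ha <;> rcases hb with rfl | hb
      · exact absurd rfl hab
      · exact fun hh => hcon b hb (hsymm _ _ hh)
      · exact hcon a ha
      · exact hω a ha b hb hab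
    · have hik : i ≠ k := fun hh => hkR (hh ▸ hi)
      exact h' i (by simp [hR] at hi ⊢; omega) k (by simp) hik h
  have hstep : P.real A - P.real A' = P.real (A ∩ ⋃ i ∈ R, B i) := by
    rw [← hdiff, measureReal_sdiff hsub hA'm]
  have hker : ∀ i ∈ R, P.real (noPairEvent X H (R.erase i) ∩ B i) =
      P.real (noPairEvent X H (R.erase i)) * p := fun i hi =>
    measureReal_noPairEvent_inter_pair hX hind hlaw hH (by simp) (by simp [hkR])
      (fun hh => hkR (hh ▸ hi))
  have hcard : (R.card : ℝ) = k := by simp [hR]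
  -- a union bound over the neighbour `i` of the new point
  have hupper : P.real (A ∩ ⋃ i ∈ R, B i) ≤ k * p * P.real A + k ^ 2 * (Q * p) := by
    have h1 : A ∩ ⋃ i ∈ R, B i ⊆ ⋃ i ∈ R, (noPairEvent X H (R.erase i) ∩ B i) := by
      rintro ω ⟨hω, hω'⟩
      simp only [Set.mem_iUnion, exists_prop] at hω' ⊢
      obtain ⟨i, hi, hB⟩ := hω'
      exact ⟨i, hi, noPairEvent_anti X H (Finset.erase_subset _ _) hω, hB⟩
    refine (measureReal_mono h1 (measure_ne_top _ _)).trans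
      ((measureReal_biUnion_finset_le _ _).trans ?_)
    calc ∑ i ∈ R, P.real (noPairEvent X H (R.erase i) ∩ B i)
        ≤ ∑ i ∈ R, (P.real A + k * p) * p := by
          refine Finset.sum_le_sum fun i hi => ?_
          rw [hker i hi]
          gcongr
          rw [← hcard]
          exact measureReal_noPairEvent_erase_le hX hind hlaw hH hsymm
      _ = k * p * P.real A + k ^ 2 * (p * p) := by
          rw [Finset.sum_const, nsmul_eq_mul, hcard]; ring
      _ ≤ k * p * P.real A + k ^ 2 * (Q * p) := by gcongr
  -- the events that `i` is the only neighbour of the new point, and has no other one, are disjoint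
  let C : ℕ → Set Ω := fun i => (noPairEvent X H (R.erase i) ∩ B i) \
    ⋃ j ∈ R.erase i, ({ω | (X k ω, X i ω) ∈ H ∧ (X i ω, X j ω) ∈ H} ∪
      {ω | (X i ω, X k ω) ∈ H ∧ (X k ω, X j ω) ∈ H})
  have hCm : ∀ i, MeasurableSet (C i) := fun i =>
    ((measurableSet_noPairEvent hX hH _).inter (hBm i k)).diff
      (Finset.measurableSet_biUnion _ fun j _ =>
        ((hBm k i).inter (hBm i j)).union ((hBm i k).inter (hBm k j)))
  have hClow : ∀ i ∈ R, p * P.real A - 2 * k * (Q * p) ≤ P.real (C i) := by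
    intro i hi
    have hik : i ≠ k := fun hh => hkR (hh ▸ hi)
    have h1 : p * P.real A ≤ P.real (noPairEvent X H (R.erase i) ∩ B i) := by
      rw [hker i hi, mul_comm]
      exact mul_le_mul_of_nonneg_right
        (measureReal_mono (noPairEvent_anti X H (Finset.erase_subset _ _))) hp0
    have h2 := le_measureReal_sdiff (h := measure_ne_top _ _) (μ := P)
      (s₁ := noPairEvent X H (R.erase i) ∩ B i)
      (s₂ := ⋃ j ∈ R.erase i, ({ω | (X k ω, X i ω) ∈ H ∧ (X i ω, X j ω) ∈ H} ∪
      {ω | (X i ω, X k ω) ∈ H ∧ (X k ω, X j ω) ∈ H}))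
    have h3 : P.real (⋃ j ∈ R.erase i, ({ω | (X k ω, X i ω) ∈ H ∧ (X i ω, X j ω) ∈ H} ∪
        {ω | (X i ω, X k ω) ∈ H ∧ (X k ω, X j ω) ∈ H})) ≤ 2 * k * (Q * p) := by
      refine (measureReal_biUnion_finset_le _ _).trans ?_
      calc _ ≤ ∑ j ∈ R.erase i, 2 * (Q * p) := by
            refine Finset.sum_le_sum fun j hj => ?_
            have hji := Finset.ne_of_mem_erase hj
            have hjk : j ≠ k := fun hh => hkR (hh ▸ Finset.mem_of_mem_erase hj)
            refine (measureReal_union_le _ _).trans ?_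
            rw [two_mul]
            exact add_le_add
              (measureReal_two_pairs_le hX hind hlaw hH hQ hik.symm hjk.symm hji.symm)
              (measureReal_two_pairs_le hX hind hlaw hH hQ hik hji.symm hjk.symm)
        _ ≤ k * (2 * (Q * p)) := by
            rw [Finset.sum_const, nsmul_eq_mul]
            have hQp : 0 ≤ Q * p := mul_nonneg (hp0.trans hpQ) hp0
            gcongr
            exact (Finset.card_le_card (Finset.erase_subset _ _)).trans_eq (by simp [hR])
        _ = _ := by ring
    linarith
  have hCdisj : Set.PairwiseDisjoint (R : Set ℕ) C := by
    intro i hi j hj hij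
    refine Set.disjoint_left.2 fun ω hω hω' => ?_
    refine hω.2 ?_
    simp only [Set.mem_iUnion, exists_prop]
    exact ⟨j, Finset.mem_erase.2 ⟨hij.symm, hj⟩, Or.inr ⟨hω.1.2, hsymm _ _ hω'.1.2⟩⟩
  have hCsub : ⋃ i ∈ R, C i ⊆ A ∩ ⋃ i ∈ R, B i := by
    intro ω hω
    simp only [Set.mem_iUnion, exists_prop] at hω
    obtain ⟨i, hi, hC⟩ := hω
    refine ⟨?_, by simp only [Set.mem_iUnion, exists_prop]; exact ⟨i, hi, hC.1.2⟩⟩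
    have hno : ∀ j ∈ R, j ≠ i → (X i ω, X j ω) ∉ H := by
      intro j hj hji hh
      refine hC.2 ?_
      simp only [Set.mem_iUnion, exists_prop]
      exact ⟨j, Finset.mem_erase.2 ⟨hji, hj⟩, Or.inl ⟨hsymm _ _ hC.1.2, hh⟩⟩
    intro a ha b hb hab
    by_cases hai : a = i
    · subst hai
      exact hno b hb hab.symm
    by_cases hbi : b = i
    · subst hbi
      exact fun h => hno a ha hab (hsymm _ _ h)
    exact hC.1.1 a (Finset.mem_erase.2 ⟨hai, ha⟩) b (Finset.mem_erase.2 ⟨hbi, hb⟩) hab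
  have hlower : k * p * P.real A - 2 * k ^ 2 * (Q * p) ≤ P.real (A ∩ ⋃ i ∈ R, B i) := by
    refine le_trans ?_ (measureReal_mono hCsub)
    rw [measureReal_biUnion_finset hCdisj fun i _ => hCm i]
    calc k * p * P.real A - 2 * k ^ 2 * (Q * p)
        = ∑ i ∈ R, (p * P.real A - 2 * k * (Q * p)) := by
          rw [Finset.sum_const, nsmul_eq_mul, hcard]; ring
      _ ≤ _ := Finset.sum_le_sum hClow
  have hQp : 0 ≤ (k : ℝ) ^ 2 * (Q * p) := mul_nonneg (sq_nonneg _) (mul_nonneg (hp0.trans hpQ) hp0)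
  rw [abs_le]
  constructor <;> nlinarith

/-- Poisson approximation for the probability that there are no related pairs among `n` independent
points, with an explicit error bound. -/
theorem abs_measureReal_noPairEvent_sub_exp_le (hX : ∀ i, Measurable (X i)) (hind : iIndepFun X P)
    (hlaw : ∀ i, P.map (X i) = μ) (hH : MeasurableSet H) (hsymm : ∀ x y, (x, y) ∈ H → (y, x) ∈ H)
    {Q : ℝ} (hQ : ∀ x, μ.real {y | (x, y) ∈ H} ≤ Q) {n : ℕ} (hn : n * (μ.prod μ).real H ≤ 1) :
    |P.real (noPairEvent X H (Finset.range n)) -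
        Real.exp (-((μ.prod μ).real H * (n * (n - 1) / 2)))| ≤
      3 * (n : ℝ) ^ 3 * (Q * (μ.prod μ).real H) := by
  set p := (μ.prod μ).real H with hp
  have hp0 : 0 ≤ p := measureReal_nonneg
  have hpQ : p ≤ Q := measureReal_prod_le hH hQ
  have hQp : 0 ≤ Q * p := mul_nonneg (hp0.trans hpQ) hp0
  suffices ∀ k : ℕ, k ≤ n → |P.real (noPairEvent X H (Finset.range k)) -
      Real.exp (-(p * (k * (k - 1) / 2)))| ≤ 3 * (k : ℝ) ^ 3 * (Q * p) from this n le_rfl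
  intro k
  induction k with
  | zero => simp [noPairEvent]
  | succ k ih =>
    intro hk
    have ih := ih (by omega)
    have hstep := abs_measureReal_noPairEvent_succ_le hX hind hlaw hH hsymm hQ k
    rw [← hp] at hstep
    set a := P.real (noPairEvent X H (Finset.range k))
    set a' := P.real (noPairEvent X H (Finset.range (k + 1)))
    set e := Real.exp (-(p * (k * (k - 1) / 2))) with he
    have hkp0 : 0 ≤ k * p := by positivity
    have hkp : k * p ≤ 1 := le_trans (by gcongr; omega) hn
    have he' : Real.exp (-(p * (((k + 1 : ℕ) : ℝ) * (((k + 1 : ℕ) : ℝ) - 1) / 2))) =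
        e * Real.exp (-(k * p)) := by
      rw [he, ← Real.exp_add]; congr 1; push_cast; ring
    have he1 : e ≤ 1 := by
      refine Real.exp_le_one_iff.2 (neg_nonpos.2 (mul_nonneg hp0 ?_))
      rcases Nat.eq_zero_or_pos k with rfl | hk0
      · simp
      · have : (1 : ℝ) ≤ k := by exact_mod_cast hk0
        have : (0 : ℝ) ≤ k - 1 := by linarith
        positivity
    have hexp : |Real.exp (-(k * p)) - (1 - k * p)| ≤ k ^ 2 * (Q * p) := by
      have h := Real.abs_exp_sub_one_sub_id_le (x := -(k * p))
        (by rw [abs_neg, abs_of_nonneg hkp0]; exact hkp)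
      calc _ = |Real.exp (-(k * p)) - 1 - -(k * p)| := by congr 1; ring
        _ ≤ _ := h
        _ = k ^ 2 * (p * p) := by ring
        _ ≤ k ^ 2 * (Q * p) := by gcongr
    rw [he']
    have hdecomp : a' - e * Real.exp (-(k * p)) = (a' - (1 - k * p) * a) + (1 - k * p) * (a - e)
        - e * (Real.exp (-(k * p)) - (1 - k * p)) := by ring
    rw [hdecomp]
    have t1 : |(1 - k * p) * (a - e)| ≤ 3 * (k : ℝ) ^ 3 * (Q * p) := by
      rw [abs_mul, abs_of_nonneg (by linarith : 0 ≤ 1 - k * p)]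
      exact (mul_le_of_le_one_left (abs_nonneg _) (by linarith)).trans ih
    have t2 : |e * (Real.exp (-(k * p)) - (1 - k * p))| ≤ k ^ 2 * (Q * p) := by
      rw [abs_mul, abs_of_nonneg (Real.exp_pos _).le]
      exact (mul_le_of_le_one_left (abs_nonneg _) he1).trans hexp
    calc _ ≤ |a' - (1 - k * p) * a| + |(1 - k * p) * (a - e)|
          + |e * (Real.exp (-(k * p)) - (1 - k * p))| :=
          (abs_sub _ _).trans (by gcongr; exact abs_add_le _ _)
      _ ≤ 2 * (k : ℝ) ^ 2 * (Q * p) + 3 * (k : ℝ) ^ 3 * (Q * p) + k ^ 2 * (Q * p) := by gcongr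
      _ = 3 * ((k : ℝ) ^ 3 + k ^ 2) * (Q * p) := by ring
      _ ≤ 3 * ((k + 1 : ℕ) : ℝ) ^ 3 * (Q * p) := by
          gcongr
          push_cast
          nlinarith [sq_nonneg (k : ℝ), (Nat.cast_nonneg k : (0 : ℝ) ≤ k)]

/-- The number of related pairs in a triangular array of independent points vanishes with
asymptotically Poissonian probability, if the expected number of neighbours of any given point is
uniformly negligible. -/
theorem tendsto_measureReal_noPairEvent (hX : ∀ i, Measurable (X i)) (hind : iIndepFun X P)
    (hlaw : ∀ i, P.map (X i) = μ) {H : ℕ → Set (E × E)} (hH : ∀ n, MeasurableSet (H n))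
    (hsymm : ∀ n x y, (x, y) ∈ H n → (y, x) ∈ H n) {Q : ℕ → ℝ}
    (hQ : ∀ᶠ n in atTop, ∀ x, μ.real {y | (x, y) ∈ H n} ≤ Q n)
    (hQ0 : Tendsto (fun n => n * Q n) atTop (𝓝 0)) {l : ℝ}
    (hp : Tendsto (fun n : ℕ => (n : ℝ) ^ 2 * (μ.prod μ).real (H n)) atTop (𝓝 (2 * l))) :
    Tendsto (fun n => P.real (noPairEvent X (H n) (Finset.range n))) atTop
      (𝓝 (Real.exp (-l))) := by
  have hinv : Tendsto (fun n : ℕ => ((n : ℝ))⁻¹) atTop (𝓝 0) :=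
    tendsto_inv_atTop_zero.comp tendsto_natCast_atTop_atTop
  have hnp : Tendsto (fun n : ℕ => n * (μ.prod μ).real (H n)) atTop (𝓝 0) := by
    have := hp.mul hinv
    rw [mul_zero] at this
    refine this.congr' ?_
    filter_upwards [eventually_gt_atTop 0] with n hn
    have : (n : ℝ) ≠ 0 := by positivity
    field_simp
  have herr : Tendsto (fun n : ℕ => 3 * (n : ℝ) ^ 3 * (Q n * (μ.prod μ).real (H n))) atTop
      (𝓝 0) := by
    have := (hQ0.mul hp).const_mul 3
    simp only [zero_mul, mul_zero] at this
    exact this.congr fun n => by ring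
  have hexp : Tendsto (fun n : ℕ => Real.exp (-((μ.prod μ).real (H n) * (n * (n - 1) / 2)))) atTop
      (𝓝 (Real.exp (-l))) := by
    refine (Real.continuous_exp.tendsto _).comp (Tendsto.neg ?_)
    have := ((hp.sub hnp).div_const 2)
    rw [sub_zero, mul_div_cancel_left₀ _ two_ne_zero] at this
    exact this.congr fun n => by ring
  have hdiff : Tendsto (fun n : ℕ => P.real (noPairEvent X (H n) (Finset.range n)) -
      Real.exp (-((μ.prod μ).real (H n) * (n * (n - 1) / 2)))) atTop (𝓝 0) := by
    refine squeeze_zero_norm' ?_ herr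
    filter_upwards [hQ, hnp.eventually (ge_mem_nhds zero_lt_one)] with n hn hn1
    exact abs_measureReal_noPairEvent_sub_exp_le hX hind hlaw (hH n) (hsymm n) hn hn1
  have := hdiff.add hexp
  simpa using this

end RelatedPairs

/-! ### The measure of a spherical cap -/

section Cap

/-- The volume of the Euclidean unit ball in dimension `k`. -/
noncomputable def unitBallVolume (k : ℕ) : ℝ :=
  volume.real (Metric.ball (0 : EuclideanSpace ℝ (Fin k)) 1)

theorem volume_ball_eq_unitBallVolume (k : ℕ) {r : ℝ} (hr : 0 < r) :
    volume (Metric.ball (0 : EuclideanSpace ℝ (Fin k)) r) =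
      ENNReal.ofReal (unitBallVolume k * r ^ k) := by
  rw [Measure.addHaar_ball_of_pos _ _ hr, finrank_euclideanSpace_fin, mul_comm,
    unitBallVolume, ENNReal.ofReal_mul measureReal_nonneg, ofReal_measureReal]

/-- Splitting off the first coordinate of a Euclidean vector. -/
noncomputable def headTail (k : ℕ) (z : EuclideanSpace ℝ (Fin (k + 1))) :
    ℝ × EuclideanSpace ℝ (Fin k) :=
  (z 0, WithLp.toLp 2 fun i => z i.succ)

theorem measurePreserving_headTail (k : ℕ) :
    MeasurePreserving (headTail k) volume (volume.prod volume) := by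
  have h1 := PiLp.volume_preserving_ofLp (Fin (k + 1))
  have h2 := volume_preserving_piFinSuccAbove (fun _ : Fin (k + 1) => ℝ) 0
  have h3 := (MeasurePreserving.id (volume : Measure ℝ)).prod (PiLp.volume_preserving_toLp (Fin k))
  exact (h3.comp h2).comp h1

theorem norm_sq_headTail (k : ℕ) (z : EuclideanSpace ℝ (Fin (k + 1))) :
    ‖z‖ ^ 2 = (headTail k z).1 ^ 2 + ‖(headTail k z).2‖ ^ 2 := by
  rw [EuclideanSpace.norm_sq_eq, EuclideanSpace.norm_sq_eq, Fin.sum_univ_succ]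
  simp [headTail]

theorem lintegral_ball_mul_Ioo (k : ℕ) {a s : ℝ} (ha : 0 < a) (hs : 0 ≤ s) :
    ∫⁻ h in Set.Ioo 0 s, volume (Metric.ball (0 : EuclideanSpace ℝ (Fin k)) (a * h)) =
      ENNReal.ofReal (unitBallVolume k * a ^ k * s ^ (k + 1) / (k + 1)) := by
  have h1 : ∫⁻ h in Set.Ioo 0 s, volume (Metric.ball (0 : EuclideanSpace ℝ (Fin k)) (a * h)) =
      ∫⁻ h in Set.Ioo 0 s, ENNReal.ofReal (unitBallVolume k * a ^ k * h ^ k) := by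
    refine setLIntegral_congr_fun measurableSet_Ioo fun h hh => ?_
    rw [volume_ball_eq_unitBallVolume k (mul_pos ha hh.1), mul_pow, mul_assoc]
  have hκ : 0 ≤ unitBallVolume k := measureReal_nonneg
  have hint : IntegrableOn (fun h : ℝ => unitBallVolume k * a ^ k * h ^ k) (Set.Ioo 0 s) :=
    ((by fun_prop : Continuous fun h : ℝ => unitBallVolume k * a ^ k * h ^ k).integrableOn_Icc
      (a := 0) (b := s)).mono_set Set.Ioo_subset_Icc_self
  rw [h1, ← ofReal_integral_eq_lintegral_ofReal hint, ← integral_Ioc_eq_integral_Ioo,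
    ← intervalIntegral.integral_of_le hs, intervalIntegral.integral_const_mul, integral_pow]
  · congr 1
    simp
    ring
  · refine (ae_restrict_iff' measurableSet_Ioo).2 (Eventually.of_forall fun h hh => ?_)
    have := hh.1.le
    simp only [Pi.zero_apply]
    positivity

/-- The part of the unit ball in a circular cone around the first axis contains a right circular
cone of height `c` and is contained in one of height `1`. -/
theorem volume_cone_bounds (k : ℕ) {c : ℝ} (hc : 0 < c) (hc1 : c < 1) :
    ENNReal.ofReal (unitBallVolume k * (√(1 - c ^ 2) / c) ^ k * c ^ (k + 1) / (k + 1)) ≤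
        volume {z : EuclideanSpace ℝ (Fin (k + 1)) | ‖z‖ < 1 ∧ c * ‖z‖ < z 0} ∧
      volume {z : EuclideanSpace ℝ (Fin (k + 1)) | ‖z‖ < 1 ∧ c * ‖z‖ < z 0} ≤
        ENNReal.ofReal (unitBallVolume k * (√(1 - c ^ 2) / c) ^ k / (k + 1)) := by
  set a := √(1 - c ^ 2) / c with ha_def
  have hc2 : 0 < 1 - c ^ 2 := by nlinarith
  have ha : 0 < a := div_pos (Real.sqrt_pos.2 hc2) hc
  have ha2 : a ^ 2 * c ^ 2 = 1 - c ^ 2 := by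
    rw [ha_def, div_pow, Real.sq_sqrt hc2.le]
    field_simp
  let C' : Set (ℝ × EuclideanSpace ℝ (Fin k)) :=
    {q | q.1 ^ 2 + ‖q.2‖ ^ 2 < 1 ∧ c ^ 2 * (q.1 ^ 2 + ‖q.2‖ ^ 2) < q.1 ^ 2 ∧ 0 < q.1}
  have hC' : MeasurableSet C' := by
    have o1 : IsOpen {q : ℝ × EuclideanSpace ℝ (Fin k) | q.1 ^ 2 + ‖q.2‖ ^ 2 < 1} :=
      isOpen_lt (by fun_prop) (by fun_prop)
    have o2 : IsOpen {q : ℝ × EuclideanSpace ℝ (Fin k) |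
        c ^ 2 * (q.1 ^ 2 + ‖q.2‖ ^ 2) < q.1 ^ 2} := isOpen_lt (by fun_prop) (by fun_prop)
    have o3 : IsOpen {q : ℝ × EuclideanSpace ℝ (Fin k) | 0 < q.1} :=
      isOpen_lt (by fun_prop) (by fun_prop)
    exact (o1.inter (o2.inter o3)).measurableSet
  have hpre : {z : EuclideanSpace ℝ (Fin (k + 1)) | ‖z‖ < 1 ∧ c * ‖z‖ < z 0} =
      headTail k ⁻¹' C' := by
    ext z
    have hn := norm_sq_headTail k z
    have h0 : (headTail k z).1 = z 0 := rfl
    simp only [C', Set.mem_preimage, Set.mem_ofPred_eq, ← hn]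
    rw [h0]
    have hz := norm_nonneg z
    constructor
    · rintro ⟨h1, h2⟩
      have h3 : 0 < z 0 := lt_of_le_of_lt (by positivity) h2
      refine ⟨by nlinarith, ?_, h3⟩
      rw [← mul_pow]
      exact pow_lt_pow_left₀ h2 (by positivity) two_ne_zero
    · rintro ⟨h1, h2, h3⟩
      rw [← mul_pow] at h2
      exact ⟨by nlinarith, lt_of_pow_lt_pow_left₀ 2 h3.le h2⟩
  rw [hpre, (measurePreserving_headTail k).measure_preimage hC'.nullMeasurableSet,
    Measure.prod_apply hC']
  constructor
  · rw [← lintegral_ball_mul_Ioo k ha hc.le, ← lintegral_indicator measurableSet_Ioo]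
    refine lintegral_mono fun h => ?_
    by_cases hh : h ∈ Set.Ioo 0 c
    · rw [Set.indicator_of_mem hh]
      refine measure_mono fun w hw => ?_
      rw [Metric.mem_ball, dist_zero_right] at hw
      have h1 : ‖w‖ ^ 2 < (a * h) ^ 2 := pow_lt_pow_left₀ hw (norm_nonneg w) two_ne_zero
      have h2 : c ^ 2 * ‖w‖ ^ 2 < (1 - c ^ 2) * h ^ 2 := by
        rw [← ha2]
        nlinarith [sq_pos_of_pos hc]
      have h3 : h ^ 2 < c ^ 2 := pow_lt_pow_left₀ hh.2 hh.1.le two_ne_zero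
      refine ⟨?_, ?_, hh.1⟩
      · have : c ^ 2 * (h ^ 2 + ‖w‖ ^ 2) < c ^ 2 * 1 := by nlinarith
        exact lt_of_mul_lt_mul_left this (sq_nonneg c)
      · change c ^ 2 * (h ^ 2 + ‖w‖ ^ 2) < h ^ 2
        nlinarith
    · rw [Set.indicator_of_notMem hh]
      exact zero_le
  · have e := lintegral_ball_mul_Ioo k ha zero_le_one
    rw [one_pow, mul_one] at e
    rw [← e, ← lintegral_indicator measurableSet_Ioo]
    refine lintegral_mono fun h => ?_
    by_cases hh : h ∈ Set.Ioo (0 : ℝ) 1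
    · rw [Set.indicator_of_mem hh]
      refine measure_mono fun w hw => ?_
      obtain ⟨-, h2, -⟩ := hw
      change c ^ 2 * (h ^ 2 + ‖w‖ ^ 2) < h ^ 2 at h2
      rw [Metric.mem_ball, dist_zero_right]
      refine lt_of_pow_lt_pow_left₀ 2 (mul_pos ha hh.1).le ?_
      have h3 : c ^ 2 * ‖w‖ ^ 2 < c ^ 2 * (a * h) ^ 2 := by
        calc c ^ 2 * ‖w‖ ^ 2 < (1 - c ^ 2) * h ^ 2 := by linarith
          _ = c ^ 2 * (a * h) ^ 2 := by rw [← ha2]; ring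
      exact lt_of_mul_lt_mul_left h3 (sq_nonneg c)
    · rw [Set.indicator_of_notMem hh]
      refine le_of_eq (measure_mono_null (fun w hw => ?_) measure_empty)
      obtain ⟨h1, -, h3⟩ := hw
      change h ^ 2 + ‖w‖ ^ 2 < 1 at h1
      exact hh ⟨h3, by nlinarith [sq_nonneg ‖w‖, (show 0 < h from h3)]⟩

open scoped Pointwise in
/-- The surface measure of a spherical cap of angular radius `arccos c`, up to the factor
`c ^ (k + 1)`. -/
theorem toSphere_cap_bounds (k : ℕ) {e : EuclideanSpace ℝ (Fin (k + 1))} (he : ‖e‖ = 1) {c : ℝ}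
    (hc : 0 < c) (hc1 : c < 1) :
    ENNReal.ofReal (unitBallVolume k * (√(1 - c ^ 2) / c) ^ k * c ^ (k + 1)) ≤
        (volume : Measure (EuclideanSpace ℝ (Fin (k + 1)))).toSphere
          {ω | c < inner ℝ e (ω : EuclideanSpace ℝ (Fin (k + 1)))} ∧
      (volume : Measure (EuclideanSpace ℝ (Fin (k + 1)))).toSphere
          {ω | c < inner ℝ e (ω : EuclideanSpace ℝ (Fin (k + 1)))} ≤
        ENNReal.ofReal (unitBallVolume k * (√(1 - c ^ 2) / c) ^ k) := by
  have hmeas : MeasurableSet {ω : Metric.sphere (0 : EuclideanSpace ℝ (Fin (k + 1))) 1 |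
      c < inner ℝ e (ω : EuclideanSpace ℝ (Fin (k + 1)))} :=
    (isOpen_lt continuous_const (by fun_prop)).measurableSet
  have hset : (Set.Ioo (0 : ℝ) 1 • (Subtype.val ''
      {ω : Metric.sphere (0 : EuclideanSpace ℝ (Fin (k + 1))) 1 |
      c < inner ℝ e (ω : EuclideanSpace ℝ (Fin (k + 1)))}) : Set (EuclideanSpace ℝ (Fin (k + 1)))) =
      {y | ‖y‖ < 1 ∧ c * ‖y‖ < inner ℝ e y} := by
    ext y
    simp only [Set.mem_smul, Set.mem_image, Set.mem_ofPred_eq]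
    constructor
    · rintro ⟨r, hr, _, ⟨ω, hω, rfl⟩, rfl⟩
      have hn : ‖(ω : EuclideanSpace ℝ (Fin (k + 1)))‖ = 1 := by simp
      rw [norm_smul, hn, mul_one, Real.norm_of_nonneg hr.1.le, inner_smul_right, mul_comm c]
      exact ⟨hr.2, mul_lt_mul_of_pos_left hω hr.1⟩
    · rintro ⟨h1, h2⟩
      have hy : 0 < ‖y‖ := by
        rw [norm_pos_iff]
        rintro rfl
        simp at h2
      refine ⟨‖y‖, ⟨hy, h1⟩, ‖y‖⁻¹ • y, ⟨⟨‖y‖⁻¹ • y, ?_⟩, ?_, rfl⟩, ?_⟩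
      · simp [norm_smul, hy.ne']
      · change c < inner ℝ e (‖y‖⁻¹ • y)
        rw [inner_smul_right, ← div_eq_inv_mul, lt_div_iff₀ hy]
        exact h2
      · simp [smul_smul, mul_inv_cancel₀ hy.ne']
  have hon : Orthonormal ℝ (({0} : Set (Fin (k + 1))).domRestrict fun _ => e) := by
    refine ⟨fun _ => he, fun i j hij => (hij (Subsingleton.elim _ _)).elim⟩
  obtain ⟨b, hb⟩ := hon.exists_orthonormalBasis_extension_of_card_eq (v := fun _ => e) (by simp)
  have hb0 : b 0 = e := hb 0 rfl
  have hvol : volume {y : EuclideanSpace ℝ (Fin (k + 1)) | ‖y‖ < 1 ∧ c * ‖y‖ < inner ℝ e y} =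
      volume {z : EuclideanSpace ℝ (Fin (k + 1)) | ‖z‖ < 1 ∧ c * ‖z‖ < z 0} := by
    have hm : MeasurableSet {z : EuclideanSpace ℝ (Fin (k + 1)) | ‖z‖ < 1 ∧ c * ‖z‖ < z 0} :=
      ((isOpen_lt (f := fun z : EuclideanSpace ℝ (Fin (k + 1)) => ‖z‖)
        (by fun_prop) (by fun_prop)).inter
        (isOpen_lt (f := fun z : EuclideanSpace ℝ (Fin (k + 1)) => c * ‖z‖)
          (by fun_prop) (by fun_prop))).measurableSet
    rw [← b.measurePreserving_repr.measure_preimage hm.nullMeasurableSet]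
    congr 1
    ext y
    simp [b.repr_apply_apply, hb0]
  rw [Measure.toSphere_apply' _ hmeas, hset, hvol, finrank_euclideanSpace_fin]
  have hk : ((k + 1 : ℕ) : ENNReal) = ENNReal.ofReal ((k : ℝ) + 1) := by
    rw [← ENNReal.ofReal_natCast]; push_cast; rfl
  have hk0 : (0 : ℝ) < (k : ℝ) + 1 := by positivity
  obtain ⟨h1, h2⟩ := volume_cone_bounds k hc hc1
  rw [hk]
  constructor
  · refine le_trans (le_of_eq ?_) (mul_le_mul_right h1 _)
    rw [← ENNReal.ofReal_mul hk0.le]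
    congr 1
    field_simp
  · refine (mul_le_mul_right h2 _).trans (le_of_eq ?_)
    rw [← ENNReal.ofReal_mul hk0.le]
    congr 1
    field_simp

end Cap

/-! ### Integration in polar coordinates -/

section Polar

theorem lintegral_eq_lintegral_polar (k : ℕ) {F : EuclideanSpace ℝ (Fin (k + 1)) → ENNReal}
    (hF : Measurable F) :
    ∫⁻ x, F x = ∫⁻ r in Set.Ioi (0 : ℝ), ENNReal.ofReal (r ^ k) *
      ∫⁻ ω, F (r • (ω : EuclideanSpace ℝ (Fin (k + 1))))
        ∂(volume : Measure (EuclideanSpace ℝ (Fin (k + 1)))).toSphere := by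
  have hmp :=
    (volume : Measure (EuclideanSpace ℝ (Fin (k + 1)))).measurePreserving_homeomorphUnitSphereProd
  rw [finrank_euclideanSpace_fin, Nat.add_sub_cancel] at hmp
  set σ := (volume : Measure (EuclideanSpace ℝ (Fin (k + 1)))).toSphere with hσ
  let F' : Metric.sphere (0 : EuclideanSpace ℝ (Fin (k + 1))) 1 × Set.Ioi (0 : ℝ) → ENNReal :=
    fun p => F ((p.2 : ℝ) • (p.1 : EuclideanSpace ℝ (Fin (k + 1))))
  have hF' : Measurable F' := hF.comp (by fun_prop)
  calc ∫⁻ x, F x = ∫⁻ x in ({0}ᶜ : Set (EuclideanSpace ℝ (Fin (k + 1)))), F x := by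
        rw [restrict_compl_singleton]
    _ = ∫⁻ x : ({0}ᶜ : Set (EuclideanSpace ℝ (Fin (k + 1)))), F x ∂(volume.comap Subtype.val) :=
        (lintegral_subtype_comap (measurableSet_singleton _).compl F).symm
    _ = ∫⁻ x : ({0}ᶜ : Set (EuclideanSpace ℝ (Fin (k + 1)))),
          F' (homeomorphUnitSphereProd _ x) ∂(volume.comap Subtype.val) := by
        refine lintegral_congr fun x => ?_
        have hx : ‖(x : EuclideanSpace ℝ (Fin (k + 1)))‖ ≠ 0 := norm_ne_zero_iff.2 x.2
        simp [F', smul_smul, hx]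
    _ = ∫⁻ p, F' p ∂(σ.prod (Measure.volumeIoiPow k)) := hmp.lintegral_comp hF'
    _ = ∫⁻ r : Set.Ioi (0 : ℝ), ∫⁻ ω, F' (ω, r) ∂σ ∂(Measure.volumeIoiPow k) :=
        lintegral_prod_symm' _ hF'
    _ = ∫⁻ r : Set.Ioi (0 : ℝ), ENNReal.ofReal ((r : ℝ) ^ k) * ∫⁻ ω, F' (ω, r) ∂σ
          ∂(volume.comap Subtype.val) := by
        rw [Measure.volumeIoiPow, lintegral_withDensity_eq_lintegral_mul _ (by fun_prop)
          hF'.lintegral_prod_left']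
        rfl
    _ = _ := lintegral_subtype_comap measurableSet_Ioi (fun r : ℝ => ENNReal.ofReal (r ^ k) *
          ∫⁻ ω, F (r • (ω : EuclideanSpace ℝ (Fin (k + 1)))) ∂σ)

/-- The surface area of the unit sphere in dimension `k + 1`. -/
noncomputable def unitSphereArea (k : ℕ) : ℝ :=
  (volume : Measure (EuclideanSpace ℝ (Fin (k + 1)))).toSphere.real Set.univ

/-- The integral of a radial function over a spherical shell. -/
theorem setLIntegral_norm_eq (k : ℕ) {φ : ℝ → ENNReal} (hφ : Measurable φ) {A : Set ℝ}
    (hA : MeasurableSet A) (hA0 : A ⊆ Set.Ioi 0) :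
    ∫⁻ x in {x : EuclideanSpace ℝ (Fin (k + 1)) | ‖x‖ ∈ A}, φ ‖x‖ =
      ENNReal.ofReal (unitSphereArea k) *
        ∫⁻ r in A, ENNReal.ofReal (r ^ k) * φ r := by
  have hm : MeasurableSet {x : EuclideanSpace ℝ (Fin (k + 1)) | ‖x‖ ∈ A} :=
    measurable_norm hA
  rw [← lintegral_indicator hm, lintegral_eq_lintegral_polar k
    ((show Measurable fun x : EuclideanSpace ℝ (Fin (k + 1)) => φ ‖x‖ from
      hφ.comp measurable_norm).indicator hm), ← lintegral_const_mul' _ _ ENNReal.ofReal_ne_top,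
    ← lintegral_indicator measurableSet_Ioi, ← lintegral_indicator hA]
  refine lintegral_congr fun r => ?_
  by_cases hr : r ∈ Set.Ioi (0 : ℝ)
  · have hr0 : 0 < r := hr
    rw [Set.indicator_of_mem hr]
    by_cases hr' : r ∈ A
    · rw [Set.indicator_of_mem hr']
      have : ∀ ω : Metric.sphere (0 : EuclideanSpace ℝ (Fin (k + 1))) 1,
          Set.indicator {x : EuclideanSpace ℝ (Fin (k + 1)) | ‖x‖ ∈ A}
            (fun x => φ ‖x‖) (r • (ω : EuclideanSpace ℝ (Fin (k + 1)))) = φ r := by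
        intro ω
        have hn : ‖r • (ω : EuclideanSpace ℝ (Fin (k + 1)))‖ = r := by
          simp [norm_smul, abs_of_pos hr0]
        rw [Set.indicator_of_mem (by rw [Set.mem_ofPred_eq, hn]; exact hr'), hn]
      simp_rw [this]
      rw [lintegral_const, unitSphereArea, ofReal_measureReal]
      ring
    · rw [Set.indicator_of_notMem hr']
      have : ∀ ω : Metric.sphere (0 : EuclideanSpace ℝ (Fin (k + 1))) 1,
          Set.indicator {x : EuclideanSpace ℝ (Fin (k + 1)) | ‖x‖ ∈ A}
            (fun x => φ ‖x‖) (r • (ω : EuclideanSpace ℝ (Fin (k + 1)))) = 0 := by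
        intro ω
        have hn : ‖r • (ω : EuclideanSpace ℝ (Fin (k + 1)))‖ = r := by
          simp [norm_smul, abs_of_pos hr0]
        rw [Set.indicator_of_notMem (by rw [Set.mem_ofPred_eq, hn]; exact hr')]
      simp_rw [this]
      simp
  · rw [Set.indicator_of_notMem hr, Set.indicator_of_notMem
      (fun h => hr (hA0 h))]

/-- The integral of a radial function over the points of a ball at distance more than `t` from `x`,
in polar coordinates. -/
theorem setLIntegral_dist_gt_eq (k : ℕ) {φ : ℝ → ENNReal} (hφ : Measurable φ) {t B : ℝ}
    {x : EuclideanSpace ℝ (Fin (k + 1))} (hx : ‖x‖ ≤ t) :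
    ∫⁻ y in {y : EuclideanSpace ℝ (Fin (k + 1)) | t < ‖x - y‖ ∧ ‖y‖ ≤ B}, φ ‖y‖ =
      ∫⁻ s in Set.Ioc (t - ‖x‖) B, ENNReal.ofReal (s ^ k) * (φ s *
        (volume : Measure (EuclideanSpace ℝ (Fin (k + 1)))).toSphere
          {ω | t < ‖x - s • (ω : EuclideanSpace ℝ (Fin (k + 1)))‖}) := by
  have hm : MeasurableSet {y : EuclideanSpace ℝ (Fin (k + 1)) | t < ‖x - y‖ ∧ ‖y‖ ≤ B} :=
    (isOpen_lt (g := fun y => ‖x - y‖) continuous_const (by fun_prop)).measurableSet.inter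
      (isClosed_le (f := fun y : EuclideanSpace ℝ (Fin (k + 1)) => ‖y‖)
        (by fun_prop) continuous_const).measurableSet
  rw [← lintegral_indicator hm, lintegral_eq_lintegral_polar k
    ((show Measurable fun x : EuclideanSpace ℝ (Fin (k + 1)) => φ ‖x‖ from
      hφ.comp measurable_norm).indicator hm),
    ← lintegral_indicator measurableSet_Ioi, ← lintegral_indicator measurableSet_Ioc]
  refine lintegral_congr fun s => ?_
  by_cases hs : s ∈ Set.Ioi (0 : ℝ)
  · have hs0 : 0 < s := hs
    rw [Set.indicator_of_mem hs]
    have hn : ∀ ω : Metric.sphere (0 : EuclideanSpace ℝ (Fin (k + 1))) 1,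
        ‖s • (ω : EuclideanSpace ℝ (Fin (k + 1)))‖ = s := fun ω => by
      simp [norm_smul, abs_of_pos hs0]
    have hcapm : MeasurableSet {ω : Metric.sphere (0 : EuclideanSpace ℝ (Fin (k + 1))) 1 |
        t < ‖x - s • (ω : EuclideanSpace ℝ (Fin (k + 1)))‖} :=
      (isOpen_lt continuous_const (by fun_prop)).measurableSet
    by_cases hs' : s ∈ Set.Ioc (t - ‖x‖) B
    · rw [Set.indicator_of_mem hs', ← lintegral_indicator_const hcapm]
      congr 1
      refine lintegral_congr fun ω => ?_
      by_cases h : t < ‖x - s • (ω : EuclideanSpace ℝ (Fin (k + 1)))‖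
      · rw [Set.indicator_of_mem (by exact ⟨h, (hn ω).trans_le hs'.2⟩),
          Set.indicator_of_mem (by exact h), hn]
      · rw [Set.indicator_of_notMem (fun hh => h hh.1),
          Set.indicator_of_notMem (by exact h)]
    · rw [Set.indicator_of_notMem hs']
      rw [mul_eq_zero]
      right
      rw [lintegral_eq_zero_iff' (by
        exact (((hφ.comp measurable_norm).indicator hm).comp (by fun_prop)).aemeasurable)]
      refine Eventually.of_forall fun ω => Set.indicator_of_notMem (fun hh => hs' ?_) _
      obtain ⟨h1, h2⟩ := hh
      rw [hn] at h2
      refine ⟨?_, h2⟩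
      have := norm_sub_le x (s • (ω : EuclideanSpace ℝ (Fin (k + 1))))
      rw [hn] at this
      linarith
  · rw [Set.indicator_of_notMem hs, Set.indicator_of_notMem]
    intro h
    have h1 := h.1
    exact hs (by rw [Set.mem_Ioi]; linarith)

theorem setLIntegral_Ioc_comp_affine {φ : ℝ → ENNReal} {a B δ : ℝ} (hδ : 0 < δ) :
    ∫⁻ s in Set.Ioc a B, φ ((s - a) / δ) =
      ENNReal.ofReal δ * ∫⁻ z in Set.Ioc 0 ((B - a) / δ), φ z := by
  have himg : (fun z => δ * z + a) '' Set.Ioc 0 ((B - a) / δ) = Set.Ioc a B := by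
    ext s
    simp only [Set.mem_image, Set.mem_Ioc]
    constructor
    · rintro ⟨z, ⟨h1, h2⟩, rfl⟩
      rw [le_div_iff₀ hδ] at h2
      constructor <;> nlinarith
    · rintro ⟨h1, h2⟩
      refine ⟨(s - a) / δ, ⟨div_pos (by linarith) hδ, ?_⟩, by field_simp; ring⟩
      gcongr
  rw [← himg, lintegral_image_eq_lintegral_abs_deriv_mul (f' := fun _ => δ) measurableSet_Ioc
    (fun z _ => by
      simpa using (((hasDerivAt_id z).const_mul δ).add_const a).hasDerivWithinAt) ?_]
  · rw [← lintegral_const_mul' _ _ ENNReal.ofReal_ne_top, abs_of_pos hδ]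
    refine lintegral_congr fun z => ?_
    congr 2
    field_simp
    ring
  · intro z _ z' _ h
    simpa [hδ.ne'] using h

/-- The incomplete Gamma integral `∫₀ʷ e^{-z} z^m dz`, as an extended nonnegative number. -/
noncomputable def lowerGamma (m w : ℝ) : ENNReal :=
  ∫⁻ z in Set.Ioc 0 w, ENNReal.ofReal (Real.exp (-z) * z ^ m)

theorem lowerGamma_mono (m : ℝ) : Monotone (lowerGamma m) :=
  fun _ _ h => lintegral_mono_set (Set.Ioc_subset_Ioc_right h)

theorem setLIntegral_exp_mul_rpow {m a B δ : ℝ} (hδ : 0 < δ) :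
    ∫⁻ s in Set.Ioc a B, ENNReal.ofReal (Real.exp (-(s / δ)) * ((s - a) / δ) ^ m) =
      ENNReal.ofReal (δ * Real.exp (-(a / δ))) * lowerGamma m ((B - a) / δ) := by
  have h := setLIntegral_Ioc_comp_affine (φ := fun z => ENNReal.ofReal (Real.exp (-(a / δ))) *
    ENNReal.ofReal (Real.exp (-z) * z ^ m)) (a := a) (B := B) hδ
  rw [lintegral_const_mul' (r := ENNReal.ofReal (Real.exp (-(a / δ))))
    (f := fun z => ENNReal.ofReal (Real.exp (-z) * z ^ m)) (hr := ENNReal.ofReal_ne_top),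
    ← mul_assoc, ← ENNReal.ofReal_mul hδ.le] at h
  rw [lowerGamma, ← h]
  refine lintegral_congr fun s => ?_
  rw [← ENNReal.ofReal_mul (Real.exp_pos _).le, ← mul_assoc, ← Real.exp_add]
  congr 3
  field_simp
  ring

end Polar

/-! ### The expected number of far pairs in an exactly solvable model -/

section Sandwich

/-- The pairs of points of the ball of radius `B` that are at distance more than `t`. -/
def farPairs (k : ℕ) (t B : ℝ) :
    Set (EuclideanSpace ℝ (Fin (k + 1)) × EuclideanSpace ℝ (Fin (k + 1))) :=
  {q | t < ‖q.1 - q.2‖ ∧ ‖q.1‖ ≤ B ∧ ‖q.2‖ ≤ B}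

theorem measurableSet_farPairs (k : ℕ) (t B : ℝ) : MeasurableSet (farPairs k t B) := by
  have h1 : Measurable fun q : EuclideanSpace ℝ (Fin (k + 1)) × EuclideanSpace ℝ (Fin (k + 1)) =>
    ‖q.1 - q.2‖ := by fun_prop
  have h2 : Measurable fun q : EuclideanSpace ℝ (Fin (k + 1)) × EuclideanSpace ℝ (Fin (k + 1)) =>
    ‖q.1‖ := by fun_prop
  have h3 : Measurable fun q : EuclideanSpace ℝ (Fin (k + 1)) × EuclideanSpace ℝ (Fin (k + 1)) =>
    ‖q.2‖ := by fun_prop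
  exact (measurableSet_lt measurable_const h1).inter
    ((measurableSet_le h2 measurable_const).inter (measurableSet_le h3 measurable_const))

theorem farPairs_symm {k : ℕ} {t B : ℝ} (x y : EuclideanSpace ℝ (Fin (k + 1)))
    (h : (x, y) ∈ farPairs k t B) : (y, x) ∈ farPairs k t B :=
  ⟨by simpa only [norm_sub_rev] using h.1, h.2.2, h.2.1⟩

theorem slice_farPairs_subset {k : ℕ} {t B : ℝ} {x : EuclideanSpace ℝ (Fin (k + 1))} :
    {y | (x, y) ∈ farPairs k t B} ⊆ {y | ‖y‖ ∈ Set.Ioc (t - B) B} := by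
  rintro y ⟨h1, h2, h3⟩
  refine ⟨?_, h3⟩
  have := norm_sub_le x y
  change t < ‖x - y‖ at h1
  change ‖x‖ ≤ B at h2
  linarith

theorem slice_farPairs_eq_empty {k : ℕ} {t B : ℝ} {x : EuclideanSpace ℝ (Fin (k + 1))}
    (hx : ‖x‖ ∉ Set.Ioc (t - B) B) : {y | (x, y) ∈ farPairs k t B} = ∅ := by
  ext y
  simp only [Set.mem_ofPred_eq, Set.mem_empty_iff_false, iff_false]
  exact fun h => hx (slice_farPairs_subset (farPairs_symm _ _ h))

theorem slice_farPairs_eq {k : ℕ} {t B : ℝ} {x : EuclideanSpace ℝ (Fin (k + 1))}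
    (hx : ‖x‖ ≤ B) : {y | (x, y) ∈ farPairs k t B} = {y | t < ‖x - y‖ ∧ ‖y‖ ≤ B} := by
  ext y
  exact ⟨fun h => ⟨h.1, h.2.2⟩, fun h => ⟨h.1, hx, h.2⟩⟩

variable {k : ℕ} {M δ ν κ m lo hi t B : ℝ} {f : EuclideanSpace ℝ (Fin (k + 1)) → ℝ}

/-- A radial density proportional to `e^{-r/δ}` with respect to Lebesgue measure in the radius. -/
noncomputable def expRadial (k : ℕ) (M δ s : ℝ) : ENNReal :=
  ENNReal.ofReal (M / δ * Real.exp (-(s / δ)) / s ^ k)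

theorem measurable_expRadial : Measurable (expRadial k M δ) := by
  unfold expRadial
  fun_prop

theorem ofReal_pow_mul_expRadial {s : ℝ} (hs : 0 < s) :
    ENNReal.ofReal (s ^ k) * expRadial k M δ s =
      ENNReal.ofReal (M / δ * Real.exp (-(s / δ))) := by
  rw [expRadial, ← ENNReal.ofReal_mul (by positivity)]
  congr 1
  field_simp

/-- The expected number of far neighbours of a point at distance `r` from the origin, for the
model density `expRadial` and with the measure of spherical caps replaced by its leading term. -/
noncomputable def modelSlice (M δ κ m t B r : ℝ) : ENNReal :=
  ENNReal.ofReal (M * κ * Real.exp (-((t - r) / δ))) * lowerGamma m ((r - (t - B)) / δ)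

theorem measurable_modelSlice : Measurable (modelSlice M δ κ m t B) := by
  unfold modelSlice
  have h := (lowerGamma_mono m).measurable
  have h2 : Measurable fun r : ℝ => lowerGamma m ((r - (t - B)) / δ) := h.comp (by fun_prop)
  exact (by fun_prop : Measurable fun r : ℝ =>
    ENNReal.ofReal (M * κ * Real.exp (-((t - r) / δ)))).mul h2

/-- `modelSlice` as an integral over the distance `s` of the neighbour from the origin. -/
theorem modelSlice_eq (hδ : 0 < δ) (hM : 0 < M) (hκ : 0 < κ) {r : ℝ} :
    ENNReal.ofReal (M * κ / δ) * ∫⁻ s in Set.Ioc (t - r) B,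
      ENNReal.ofReal (Real.exp (-(s / δ)) * ((s - (t - r)) / δ) ^ m) =
      modelSlice M δ κ m t B r := by
  rw [setLIntegral_exp_mul_rpow hδ, ← mul_assoc, ← ENNReal.ofReal_mul (by positivity), modelSlice]
  congr 2
  · field_simp
  · ring_nf

/-- The expected number of far pairs in the model. The factors `e^{-r/δ}` and `e^{-(t-r)/δ}` combine
to a constant, so that all radii `r` contribute equally, up to the incomplete Gamma function. -/
theorem lintegral_modelSlice (hδ : 0 < δ) (hM : 0 < M) (hκ : 0 < κ) (htB : 0 ≤ t - B) :
    ∫⁻ r in Set.Ioc (t - B) B, ENNReal.ofReal (r ^ k) *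
      (expRadial k M δ r * modelSlice M δ κ m t B r) =
      ENNReal.ofReal (M ^ 2 * κ * Real.exp (-(t / δ))) *
        ∫⁻ w in Set.Ioc 0 ((2 * B - t) / δ), lowerGamma m w := by
  have h := setLIntegral_Ioc_comp_affine (φ := lowerGamma m) (a := t - B) (B := B) hδ
  have h2 : ∫⁻ r in Set.Ioc (t - B) B, ENNReal.ofReal (r ^ k) *
      (expRadial k M δ r * modelSlice M δ κ m t B r) =
      ∫⁻ r in Set.Ioc (t - B) B, ENNReal.ofReal (M ^ 2 * κ / δ * Real.exp (-(t / δ))) *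
        lowerGamma m ((r - (t - B)) / δ) := by
    refine setLIntegral_congr_fun measurableSet_Ioc fun r hr => ?_
    have hr0 : 0 < r := lt_of_le_of_lt htB hr.1
    rw [← mul_assoc, ofReal_pow_mul_expRadial hr0, modelSlice, ← mul_assoc,
      ← ENNReal.ofReal_mul (by positivity)]
    congr 2
    have : Real.exp (-(t / δ)) = Real.exp (-(r / δ)) * Real.exp (-((t - r) / δ)) := by
      rw [← Real.exp_add]; congr 1; ring
    rw [this]
    ring
  rw [h2, lintegral_const_mul' _ _ ENNReal.ofReal_ne_top, h, ← mul_assoc,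
    ← ENNReal.ofReal_mul (by positivity)]
  congr 2
  · field_simp
  · ring_nf

variable (hδ : 0 < δ) (hM : 0 < M) (hκ : 0 < κ) (hν : 0 < ν) (hlo : 0 < lo) (hhi : 0 < hi)
  (htB : 0 ≤ t - B)
  (hf : ∀ y, ‖y‖ ∈ Set.Ioc (t - B) B →
    lo * (M * Real.exp (-(‖y‖ / δ))) ≤ ν * δ * ‖y‖ ^ k * f y ∧
      ν * δ * ‖y‖ ^ k * f y ≤ hi * (M * Real.exp (-(‖y‖ / δ))))
  (hcap : ∀ (x : EuclideanSpace ℝ (Fin (k + 1))) (s : ℝ), ‖x‖ ∈ Set.Ioc (t - B) B →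
    s ∈ Set.Ioc (t - ‖x‖) B →
    ENNReal.ofReal (lo * (κ * ((s - (t - ‖x‖)) / δ) ^ m)) ≤
        (volume : Measure (EuclideanSpace ℝ (Fin (k + 1)))).toSphere
          {ω | t < ‖x - s • (ω : EuclideanSpace ℝ (Fin (k + 1)))‖} ∧
      (volume : Measure (EuclideanSpace ℝ (Fin (k + 1)))).toSphere
          {ω | t < ‖x - s • (ω : EuclideanSpace ℝ (Fin (k + 1)))‖} ≤
        ENNReal.ofReal (hi * (κ * ((s - (t - ‖x‖)) / δ) ^ m)))

include hδ hν hlo hhi htB hf in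
theorem expRadial_bounds {y : EuclideanSpace ℝ (Fin (k + 1))} (hy : ‖y‖ ∈ Set.Ioc (t - B) B) :
    ENNReal.ofReal lo * expRadial k M δ ‖y‖ ≤ ENNReal.ofReal ν * ENNReal.ofReal (f y) ∧
      ENNReal.ofReal ν * ENNReal.ofReal (f y) ≤ ENNReal.ofReal hi * expRadial k M δ ‖y‖ := by
  have hy0 : 0 < ‖y‖ := lt_of_le_of_lt htB hy.1
  have hyk : 0 < ‖y‖ ^ k := pow_pos hy0 k
  obtain ⟨h1, h2⟩ := hf y hy
  have e : ∀ a, a * (M / δ * Real.exp (-(‖y‖ / δ)) / ‖y‖ ^ k) =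
      a * (M * Real.exp (-(‖y‖ / δ))) / (δ * ‖y‖ ^ k) := fun a => by
    field_simp
  rw [expRadial, ← ENNReal.ofReal_mul hlo.le, ← ENNReal.ofReal_mul hhi.le,
    ← ENNReal.ofReal_mul hν.le, e, e]
  constructor
  · refine ENNReal.ofReal_le_ofReal ?_
    rw [div_le_iff₀ (by positivity)]
    linarith
  · refine ENNReal.ofReal_le_ofReal ?_
    rw [le_div_iff₀ (by positivity)]
    linarith

include hδ hM hκ hν hlo hhi htB hf hcap in
/-- The expected number of far neighbours of a given point, up to the accuracy of the approximations
of the density and of the measure of spherical caps. -/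
theorem slice_bounds {x : EuclideanSpace ℝ (Fin (k + 1))} (hx : ‖x‖ ∈ Set.Ioc (t - B) B) :
    ENNReal.ofReal (lo ^ 2) * modelSlice M δ κ m t B ‖x‖ ≤ ENNReal.ofReal ν *
        (volume.withDensity fun x => ENNReal.ofReal (f x)) {y | (x, y) ∈ farPairs k t B} ∧
      ENNReal.ofReal ν *
        (volume.withDensity fun x => ENNReal.ofReal (f x)) {y | (x, y) ∈ farPairs k t B} ≤
        ENNReal.ofReal (hi ^ 2) * modelSlice M δ κ m t B ‖x‖ := by
  have hms : MeasurableSet {y | (x, y) ∈ farPairs k t B} :=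
    measurable_prodMk_left (measurableSet_farPairs k t B)
  have hxt : ‖x‖ ≤ t := by
    have := norm_nonneg x
    have := hx.2
    linarith
  have hpolar := setLIntegral_dist_gt_eq k (measurable_expRadial (k := k) (M := M) (δ := δ))
    (B := B) hxt
  rw [← slice_farPairs_eq hx.2] at hpolar
  rw [withDensity_apply _ hms, ← lintegral_const_mul' _ _ ENNReal.ofReal_ne_top]
  have hpos : ∀ s ∈ Set.Ioc (t - ‖x‖) B, 0 < s ∧ 0 ≤ (s - (t - ‖x‖)) / δ := fun s hs =>
    ⟨by linarith [hs.1, hx.2], div_nonneg (by linarith [hs.1]) hδ.le⟩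
  constructor
  · calc ENNReal.ofReal (lo ^ 2) * modelSlice M δ κ m t B ‖x‖
        = ENNReal.ofReal lo * ∫⁻ s in Set.Ioc (t - ‖x‖) B, ENNReal.ofReal (M * κ / δ) *
            (ENNReal.ofReal lo *
              ENNReal.ofReal (Real.exp (-(s / δ)) * ((s - (t - ‖x‖)) / δ) ^ m)) := by
          rw [← modelSlice_eq hδ hM hκ, lintegral_const_mul' _ _ ENNReal.ofReal_ne_top,
            lintegral_const_mul' _ _ ENNReal.ofReal_ne_top, pow_two, ENNReal.ofReal_mul hlo.le]
          ring
      _ ≤ ENNReal.ofReal lo * ∫⁻ y in {y | (x, y) ∈ farPairs k t B}, expRadial k M δ ‖y‖ := by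
          rw [hpolar]
          gcongr ENNReal.ofReal lo * ?_
          refine setLIntegral_mono' measurableSet_Ioc fun s hs => ?_
          obtain ⟨hs0, hz⟩ := hpos s hs
          rw [← mul_assoc (ENNReal.ofReal (s ^ k)), ofReal_pow_mul_expRadial hs0]
          refine le_trans (le_of_eq ?_) (mul_le_mul_right (hcap x s hx hs).1 _)
          rw [← ENNReal.ofReal_mul hlo.le, ← ENNReal.ofReal_mul (by positivity),
            ← ENNReal.ofReal_mul (by positivity)]
          congr 1
          ring
      _ ≤ _ := by
          rw [← lintegral_const_mul' _ _ ENNReal.ofReal_ne_top]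
          exact setLIntegral_mono' hms fun y hy =>
            (expRadial_bounds hδ hν hlo hhi htB hf (slice_farPairs_subset hy)).1
  · calc _ ≤ ENNReal.ofReal hi * ∫⁻ y in {y | (x, y) ∈ farPairs k t B}, expRadial k M δ ‖y‖ := by
          rw [← lintegral_const_mul' _ _ ENNReal.ofReal_ne_top]
          exact setLIntegral_mono' hms fun y hy =>
            (expRadial_bounds hδ hν hlo hhi htB hf (slice_farPairs_subset hy)).2
      _ ≤ ENNReal.ofReal hi * ∫⁻ s in Set.Ioc (t - ‖x‖) B, ENNReal.ofReal (M * κ / δ) *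
            (ENNReal.ofReal hi *
              ENNReal.ofReal (Real.exp (-(s / δ)) * ((s - (t - ‖x‖)) / δ) ^ m)) := by
          rw [hpolar]
          gcongr ENNReal.ofReal hi * ?_
          refine setLIntegral_mono' measurableSet_Ioc fun s hs => ?_
          obtain ⟨hs0, hz⟩ := hpos s hs
          rw [← mul_assoc (ENNReal.ofReal (s ^ k)), ofReal_pow_mul_expRadial hs0]
          refine (mul_le_mul_right (hcap x s hx hs).2 _).trans (le_of_eq ?_)
          rw [← ENNReal.ofReal_mul hhi.le, ← ENNReal.ofReal_mul (by positivity),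
            ← ENNReal.ofReal_mul (by positivity)]
          congr 1
          ring
      _ = ENNReal.ofReal (hi ^ 2) * modelSlice M δ κ m t B ‖x‖ := by
          rw [← modelSlice_eq hδ hM hκ, lintegral_const_mul' _ _ ENNReal.ofReal_ne_top,
            lintegral_const_mul' _ _ ENNReal.ofReal_ne_top, pow_two, ENNReal.ofReal_mul hhi.le]
          ring

include hδ hM hκ hν hlo hhi htB hf hcap in
/-- The expected number of far pairs, up to the accuracy of the approximations of the density and
of the measure of spherical caps. -/
theorem measure_farPairs_bounds (hfm : AEMeasurable f)
    [IsProbabilityMeasure (volume.withDensity fun x => ENNReal.ofReal (f x))] :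
    ENNReal.ofReal (lo ^ 3 * (unitSphereArea k * (M ^ 2 * κ * Real.exp (-(t / δ))))) *
        ∫⁻ w in Set.Ioc 0 ((2 * B - t) / δ), lowerGamma m w ≤ ENNReal.ofReal (ν ^ 2) *
        ((volume.withDensity fun x => ENNReal.ofReal (f x)).prod
          (volume.withDensity fun x => ENNReal.ofReal (f x))) (farPairs k t B) ∧
      ENNReal.ofReal (ν ^ 2) *
        ((volume.withDensity fun x => ENNReal.ofReal (f x)).prod
          (volume.withDensity fun x => ENNReal.ofReal (f x))) (farPairs k t B) ≤
        ENNReal.ofReal (hi ^ 3 * (unitSphereArea k * (M ^ 2 * κ * Real.exp (-(t / δ))))) *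
          ∫⁻ w in Set.Ioc 0 ((2 * B - t) / δ), lowerGamma m w := by
  set μ : Measure (EuclideanSpace ℝ (Fin (k + 1))) :=
    volume.withDensity fun x => ENNReal.ofReal (f x) with hμ
  have hH := measurableSet_farPairs k t B
  set A : Set (EuclideanSpace ℝ (Fin (k + 1))) := {x | ‖x‖ ∈ Set.Ioc (t - B) B} with hA
  have hAm : MeasurableSet A := measurable_norm measurableSet_Ioc
  have hω : 0 ≤ unitSphereArea k := measureReal_nonneg
  have hslice : Measurable fun x => μ (Prod.mk x ⁻¹' farPairs k t B) :=
    measurable_measure_prodMk_left hH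
  have hmain : ENNReal.ofReal (ν ^ 2) * (μ.prod μ) (farPairs k t B) =
      ∫⁻ x in A, (ENNReal.ofReal ν * ENNReal.ofReal (f x)) *
        (ENNReal.ofReal ν * μ {y | (x, y) ∈ farPairs k t B}) := by
    rw [Measure.prod_apply hH]
    conv_lhs => rw [hμ]
    rw [lintegral_withDensity_eq_lintegral_mul₀ hfm.ennreal_ofReal hslice.aemeasurable,
      ← lintegral_const_mul' _ _ ENNReal.ofReal_ne_top, ← lintegral_indicator hAm]
    refine lintegral_congr fun x => ?_
    by_cases hx : x ∈ A
    · rw [Set.indicator_of_mem hx, pow_two, ENNReal.ofReal_mul hν.le, Pi.mul_apply]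
      change _ * _ * (_ * μ {y | (x, y) ∈ farPairs k t B}) = _
      ring
    · rw [Set.indicator_of_notMem hx, Pi.mul_apply]
      change _ * (_ * μ {y | (x, y) ∈ farPairs k t B}) = _
      rw [slice_farPairs_eq_empty hx]
      simp
  have hmodel : ∀ a : ℝ, 0 < a → ∫⁻ x in A, ENNReal.ofReal (a ^ 3) *
      (expRadial k M δ ‖x‖ * modelSlice M δ κ m t B ‖x‖) =
      ENNReal.ofReal (a ^ 3 * (unitSphereArea k * (M ^ 2 * κ * Real.exp (-(t / δ))))) *
        ∫⁻ w in Set.Ioc 0 ((2 * B - t) / δ), lowerGamma m w := by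
    intro a ha
    rw [lintegral_const_mul' _ _ ENNReal.ofReal_ne_top,
      setLIntegral_norm_eq k (φ := fun r => expRadial k M δ r * modelSlice M δ κ m t B r)
      (measurable_expRadial.mul measurable_modelSlice) measurableSet_Ioc
      (fun r hr => lt_of_le_of_lt htB hr.1), lintegral_modelSlice hδ hM hκ htB,
      ENNReal.ofReal_mul (p := a ^ 3) (by positivity), ENNReal.ofReal_mul hω]
    ring
  rw [hmain, ← hmodel lo hlo, ← hmodel hi hhi]
  have hcube : ∀ (a : ℝ) (u v : ENNReal), 0 < a → ENNReal.ofReal (a ^ 3) * (u * v) =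
      (ENNReal.ofReal a * u) * (ENNReal.ofReal (a ^ 2) * v) := by
    intro a u v ha
    rw [pow_succ, ENNReal.ofReal_mul (by positivity)]
    ring
  constructor
  · refine setLIntegral_mono' hAm fun x hx => ?_
    rw [hcube _ _ _ hlo]
    exact mul_le_mul' (expRadial_bounds hδ hν hlo hhi htB hf hx).1
      (slice_bounds hδ hM hκ hν hlo hhi htB hf hcap hx).1
  · refine setLIntegral_mono' hAm fun x hx => ?_
    rw [hcube _ _ _ hhi]
    exact mul_le_mul' (expRadial_bounds hδ hν hlo hhi htB hf hx).2
      (slice_bounds hδ hM hκ hν hlo hhi htB hf hcap hx).2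

end Sandwich

/-! ### Local expansions of the density and of the distance -/

section LocalExpansions

/-- The second-order Taylor bound for `(1 + h) ^ γ`. -/
theorem exists_abs_one_add_rpow_sub_le (γ : ℝ) :
    ∃ C > 0, ∃ r > 0, ∀ h : ℝ, |h| ≤ r → |(1 + h) ^ γ - 1 - γ * h| ≤ C * h ^ 2 := by
  have hder : ∀ (q x : ℝ), -1 < x →
      HasDerivAt (fun x : ℝ => (1 + x) ^ q) (q * (1 + x) ^ (q - 1)) x := by
    intro q x hx
    have := ((hasDerivAt_id x).const_add 1).rpow_const (p := q) (Or.inl (by simp; linarith))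
    simpa using this
  have hO := (hder (γ - 1) 0 (by norm_num)).isBigO_sub
  obtain ⟨C, hC, hb⟩ := hO.exists_pos
  rw [IsBigOWith, Metric.eventually_nhds_iff] at hb
  obtain ⟨r, hr, hb⟩ := hb
  refine ⟨(|γ| + 1) * C, by positivity, min (r / 2) (1 / 2), by positivity, fun h hh => ?_⟩
  have hh1 : |h| < r := by
    have := hh.trans (min_le_left _ _)
    linarith
  have hh2 : |h| ≤ 1 / 2 := hh.trans (min_le_right _ _)
  have hmv := (convex_Icc (-|h|) |h|).norm_image_sub_le_of_norm_hasDerivWithin_le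
    (f := fun x : ℝ => (1 + x) ^ γ - 1 - γ * x) (f' := fun x => γ * (1 + x) ^ (γ - 1) - γ)
    (C := (|γ| + 1) * C * |h|) (x := 0) (y := h) (fun x hx => ?_) (fun x hx => ?_)
    ⟨by simp, by simp⟩ ⟨neg_abs_le h, le_abs_self h⟩
  · simp only [Real.norm_eq_abs, sub_zero] at hmv
    calc _ = |(1 + h) ^ γ - 1 - γ * h - ((1 + 0) ^ γ - 1 - γ * 0)| := by simp
      _ ≤ (|γ| + 1) * C * |h| * |h| := hmv
      _ = (|γ| + 1) * C * h ^ 2 := by rw [mul_assoc _ |h|, abs_mul_abs_self]; ring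
  · have hx1 : -1 < x := by linarith [hx.1]
    have h1 := ((hder γ x hx1).sub_const 1).sub ((hasDerivAt_id x).const_mul γ)
    simp only [mul_one] at h1
    exact h1.hasDerivWithinAt
  · have hx1 : |x| ≤ |h| := abs_le.2 hx
    have h1 := hb (y := x) (by simpa using hx1.trans_lt hh1)
    simp only [add_zero, Real.one_rpow, sub_zero, Real.norm_eq_abs] at h1
    rw [Real.norm_eq_abs, ← mul_sub_one, abs_mul, mul_assoc]
    gcongr
    · linarith
    · exact h1.trans (by gcongr)

/-- The density is locally exponential: `N ((1 + h)^γ - 1 - γ h)` is negligible if `N h²` is. -/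
theorem exists_abs_rpow_mul_exp_sub_one_le (p γ : ℝ) {ε : ℝ} (hε : 0 < ε) :
    ∃ η > 0, ∀ N h : ℝ, 0 ≤ N → |h| ≤ η → N * h ^ 2 ≤ η →
      |(1 + h) ^ p * Real.exp (-(N * ((1 + h) ^ γ - 1 - γ * h))) - 1| ≤ ε := by
  obtain ⟨C, hC, r, hr, hb⟩ := exists_abs_one_add_rpow_sub_le γ
  have hcont : ContinuousAt (fun q : ℝ × ℝ => (1 + q.1) ^ p * Real.exp (-q.2)) (0, 0) := by
    have h1 : ContinuousAt (fun q : ℝ × ℝ => (1 + q.1) ^ p) (0, 0) :=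
      ContinuousAt.rpow_const (by fun_prop) (Or.inl (by simp))
    exact h1.mul (by fun_prop)
  obtain ⟨θ, hθ, hball⟩ := Metric.continuousAt_iff.1 hcont ε hε
  refine ⟨min r (min (θ / 2) (θ / (2 * C))), by positivity, fun N h hN hh hNh => ?_⟩
  have h1 : |h| ≤ r := hh.trans (min_le_left _ _)
  have h2 : |h| ≤ θ / 2 := hh.trans ((min_le_right _ _).trans (min_le_left _ _))
  have h3 : N * h ^ 2 ≤ θ / (2 * C) := hNh.trans ((min_le_right _ _).trans (min_le_right _ _))
  have h4 : |N * ((1 + h) ^ γ - 1 - γ * h)| ≤ θ / 2 := by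
    rw [abs_mul, abs_of_nonneg hN]
    calc N * |(1 + h) ^ γ - 1 - γ * h| ≤ N * (C * h ^ 2) := by gcongr; exact hb h h1
      _ = C * (N * h ^ 2) := by ring
      _ ≤ C * (θ / (2 * C)) := by gcongr
      _ = θ / 2 := by field_simp
  have := hball (x := (h, N * ((1 + h) ^ γ - 1 - γ * h))) (by
    rw [Prod.dist_eq, Real.dist_eq, Real.dist_eq, sub_zero, sub_zero]
    exact max_lt (by linarith) (by linarith))
  simpa [Real.dist_eq] using this.le

/-- The squared norm of the difference of a vector and a point of a sphere, through the angle. -/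
theorem lt_norm_sub_smul_iff {E : Type*} [NormedAddCommGroup E] [InnerProductSpace ℝ E] {x ω : E}
    (hω : ‖ω‖ = 1) (hx : 0 < ‖x‖) {s t : ℝ} (hs : 0 < s) (ht : 0 < t) :
    t < ‖x - s • ω‖ ↔
      (t ^ 2 - ‖x‖ ^ 2 - s ^ 2) / (2 * ‖x‖ * s) < inner ℝ (-(‖x‖⁻¹ • x)) ω := by
  have h1 : ‖x - s • ω‖ ^ 2 = ‖x‖ ^ 2 - 2 * (s * inner ℝ x ω) + s ^ 2 := by
    rw [norm_sub_sq_real, inner_smul_right, norm_smul, hω, mul_one, Real.norm_eq_abs, sq_abs]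
  rw [← pow_lt_pow_iff_left₀ ht.le (norm_nonneg _) two_ne_zero, h1, inner_neg_left,
    real_inner_smul_left, div_lt_iff₀ (by positivity)]
  have h2 : -(‖x‖⁻¹ * inner ℝ x ω) * (2 * ‖x‖ * s) = -2 * (s * inner ℝ x ω) := by
    field_simp
  rw [h2]
  constructor <;> intro h <;> linarith

/-- Two points at distances `b (1 + h)` and `b (1 + h')` from the origin, one fixed and the other in
uniformly random direction, are at distance more than `b (2 + τ)` if the angle between the first and
the opposite of the second is small, of order the square root of `h + h' - τ`. -/
theorem exists_toSphere_far_bounds (k : ℕ) {ε : ℝ} (hε : 0 < ε) :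
    ∃ η > 0, ∀ (b h h' τ : ℝ) (x : EuclideanSpace ℝ (Fin (k + 1))), 0 < b → |h| ≤ η → |h'| ≤ η →
      |τ| ≤ η → 0 < h + h' - τ → ‖x‖ = b * (1 + h) →
      ENNReal.ofReal ((1 - ε) * (unitBallVolume k * (4 * (h + h' - τ)) ^ ((k : ℝ) / 2))) ≤
        (volume : Measure (EuclideanSpace ℝ (Fin (k + 1)))).toSphere
          {ω | b * (2 + τ) < ‖x - (b * (1 + h')) • (ω : EuclideanSpace ℝ (Fin (k + 1)))‖} ∧
      (volume : Measure (EuclideanSpace ℝ (Fin (k + 1)))).toSphere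
          {ω | b * (2 + τ) < ‖x - (b * (1 + h')) • (ω : EuclideanSpace ℝ (Fin (k + 1)))‖} ≤
        ENNReal.ofReal ((1 + ε) * (unitBallVolume k * (4 * (h + h' - τ)) ^ ((k : ℝ) / 2))) := by
  -- `c` is the cosine of the critical angle and `R` the ratio of its squared tangent to
  -- `4 (h + h' - τ)`
  let c : ℝ × ℝ × ℝ → ℝ := fun q =>
    ((2 + q.2.2) ^ 2 - (1 + q.1) ^ 2 - (1 + q.2.1) ^ 2) / (2 * (1 + q.1) * (1 + q.2.1))
  let R : ℝ × ℝ × ℝ → ℝ := fun q =>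
    (4 + q.1 + q.2.1 + q.2.2) * (1 + c q) / (8 * (1 + q.1) * (1 + q.2.1) * c q ^ 2)
  have hc0 : c 0 = 1 := by norm_num [c]
  have hR0 : R 0 = 1 := by norm_num [R, hc0]
  have hcc : ContinuousAt c 0 := ContinuousAt.div (by fun_prop) (by fun_prop) (by norm_num)
  have hRc : ContinuousAt R 0 := ContinuousAt.div (by fun_prop) (by fun_prop) (by norm_num [hc0])
  have hF1 : ContinuousAt (fun q => R q ^ ((k : ℝ) / 2)) 0 :=
    hRc.rpow_const (Or.inl (by rw [hR0]; norm_num))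
  have hF2 : ContinuousAt (fun q => R q ^ ((k : ℝ) / 2) * c q ^ (k + 1)) 0 := hF1.mul (hcc.pow _)
  have e1 : ∀ᶠ q in 𝓝 (0 : ℝ × ℝ × ℝ), R q ^ ((k : ℝ) / 2) < 1 + ε :=
    hF1.eventually_lt_const (by simp [hR0, hε])
  have e2 : ∀ᶠ q in 𝓝 (0 : ℝ × ℝ × ℝ), 1 - ε < R q ^ ((k : ℝ) / 2) * c q ^ (k + 1) :=
    hF2.eventually_const_lt (by simp [hR0, hc0, hε])
  have e3 : ∀ᶠ q in 𝓝 (0 : ℝ × ℝ × ℝ), 0 < c q := hcc.eventually_const_lt (by simp [hc0])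
  have e4 : ∀ᶠ q in 𝓝 (0 : ℝ × ℝ × ℝ), 0 < R q := hRc.eventually_const_lt (by simp [hR0])
  obtain ⟨θ, hθ, hball⟩ := Metric.eventually_nhds_iff.1 (e1.and (e2.and (e3.and e4)))
  refine ⟨min (θ / 2) (1 / 2), by positivity, fun b h h' τ x hb hh hh' hτ hz hx => ?_⟩
  have hθ' : ∀ a : ℝ, |a| ≤ min (θ / 2) (1 / 2) → |a| < θ := fun a ha => by
    have := ha.trans (min_le_left _ _)
    linarith
  have hlow : ∀ a : ℝ, |a| ≤ min (θ / 2) (1 / 2) → 0 < 1 + a := fun a ha => by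
    have := abs_le.1 (ha.trans (min_le_right _ _))
    linarith
  obtain ⟨b1, b2, b3, b4⟩ := hball (y := (h, h', τ)) (by
    rw [Prod.dist_eq, Prod.dist_eq, Prod.fst_zero, Prod.snd_zero, Prod.fst_zero, Prod.snd_zero,
      Real.dist_eq, Real.dist_eq, Real.dist_eq, sub_zero, sub_zero, sub_zero]
    exact max_lt (hθ' _ hh) (max_lt (hθ' _ hh') (hθ' _ hτ)))
  have p1 := hlow h hh
  have p2 := hlow h' hh'
  have p3 := hlow τ hτ
  have hxpos : 0 < ‖x‖ := by rw [hx]; positivity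
  set C := c (h, h', τ) with hC
  set Rq := R (h, h', τ) with hRq
  have hCeq : ((b * (2 + τ)) ^ 2 - ‖x‖ ^ 2 - (b * (1 + h')) ^ 2) / (2 * ‖x‖ * (b * (1 + h'))) =
      C := by
    rw [hx, hC]
    simp only [c]
    field_simp
  have hone : 1 - C = (h + h' - τ) * (4 + h + h' + τ) / (2 * (1 + h) * (1 + h')) := by
    rw [hC]
    simp only [c]
    field_simp
    ring
  have hC1 : C < 1 := by
    have : 0 < 1 - C := by
      rw [hone]
      have : 0 < 4 + h + h' + τ := by linarith
      positivity
    linarith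
  have htan : (√(1 - C ^ 2) / C) ^ k = (4 * (h + h' - τ)) ^ ((k : ℝ) / 2) * Rq ^ ((k : ℝ) / 2) := by
    rw [← Real.mul_rpow (by linarith) b4.le]
    have h1 : 4 * (h + h' - τ) * Rq = (√(1 - C ^ 2) / C) ^ 2 := by
      rw [div_pow, Real.sq_sqrt (by nlinarith), show 1 - C ^ 2 = (1 - C) * (1 + C) by ring, hone]
      simp only [hRq, R, ← hC]
      field_simp
      ring
    have ha : 0 ≤ √(1 - C ^ 2) / C := by positivity
    rw [h1]
    generalize √(1 - C ^ 2) / C = a at ha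
    rw [← Real.rpow_natCast a k, ← Real.rpow_two, ← Real.rpow_mul ha]
    congr 1
    ring
  have hset : {ω : Metric.sphere (0 : EuclideanSpace ℝ (Fin (k + 1))) 1 |
      b * (2 + τ) < ‖x - (b * (1 + h')) • (ω : EuclideanSpace ℝ (Fin (k + 1)))‖} =
      {ω : Metric.sphere (0 : EuclideanSpace ℝ (Fin (k + 1))) 1 |
        C < inner ℝ (-(‖x‖⁻¹ • x)) (ω : EuclideanSpace ℝ (Fin (k + 1)))} := by
    ext ω
    rw [Set.mem_ofPred_eq, Set.mem_ofPred_eq, lt_norm_sub_smul_iff (by simp) hxpos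
      (by positivity) (mul_pos hb (by linarith)), hCeq]
  obtain ⟨c1, c2⟩ := toSphere_cap_bounds k (e := -(‖x‖⁻¹ • x))
    (by rw [norm_neg, norm_smul, norm_inv, norm_norm, inv_mul_cancel₀ hxpos.ne']) b3 hC1
  rw [hset]
  rw [htan] at c1 c2
  have hvol : 0 ≤ unitBallVolume k := measureReal_nonneg
  have hz4 : 0 ≤ unitBallVolume k * (4 * (h + h' - τ)) ^ ((k : ℝ) / 2) := by positivity
  constructor
  · refine le_trans (ENNReal.ofReal_le_ofReal ?_) c1
    calc _ ≤ (Rq ^ ((k : ℝ) / 2) * C ^ (k + 1)) *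
          (unitBallVolume k * (4 * (h + h' - τ)) ^ ((k : ℝ) / 2)) :=
          mul_le_mul_of_nonneg_right b2.le hz4
      _ = _ := by ring
  · refine c2.trans (ENNReal.ofReal_le_ofReal ?_)
    calc _ = Rq ^ ((k : ℝ) / 2) * (unitBallVolume k * (4 * (h + h' - τ)) ^ ((k : ℝ) / 2)) := by ring
      _ ≤ _ := mul_le_mul_of_nonneg_right b1.le hz4

end LocalExpansions

/-! ### The incomplete Gamma function and tail integrals -/

section IncompleteGamma

variable {m : ℝ}

theorem integrableOn_exp_neg_mul_rpow (hm : 0 ≤ m) :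
    IntegrableOn (fun z : ℝ => Real.exp (-z) * z ^ m) (Set.Ioi 0) := by
  simpa using Real.GammaIntegral_convergent (s := m + 1) (by linarith)

theorem lowerGamma_eq_ofReal (hm : 0 ≤ m) (w : ℝ) :
    lowerGamma m w = ENNReal.ofReal (∫ z in Set.Ioc 0 w, Real.exp (-z) * z ^ m) := by
  rw [lowerGamma, ofReal_integral_eq_lintegral_ofReal
    ((integrableOn_exp_neg_mul_rpow hm).mono_set Set.Ioc_subset_Ioi_self)]
  refine (ae_restrict_iff' measurableSet_Ioc).2 (Eventually.of_forall fun z hz => ?_)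
  exact mul_nonneg (Real.exp_pos _).le (Real.rpow_nonneg hz.1.le m)

theorem lowerGamma_le (hm : 0 ≤ m) (w : ℝ) :
    lowerGamma m w ≤ ENNReal.ofReal (Real.Gamma (m + 1)) := by
  rw [lowerGamma_eq_ofReal hm, Real.Gamma_eq_integral (by linarith), add_sub_cancel_right]
  refine ENNReal.ofReal_le_ofReal (setIntegral_mono_set (integrableOn_exp_neg_mul_rpow hm) ?_
    (Eventually.of_forall Set.Ioc_subset_Ioi_self))
  refine (ae_restrict_iff' measurableSet_Ioi).2 (Eventually.of_forall fun z hz => ?_)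
  exact mul_nonneg (Real.exp_pos _).le (Real.rpow_nonneg (le_of_lt hz) m)

theorem tendsto_integral_Ioc_Gamma (hm : 0 ≤ m) :
    Tendsto (fun w => ∫ z in Set.Ioc 0 w, Real.exp (-z) * z ^ m) atTop
      (𝓝 (Real.Gamma (m + 1))) := by
  have h := intervalIntegral_tendsto_integral_Ioi 0 (integrableOn_exp_neg_mul_rpow hm) tendsto_id
  rw [Real.Gamma_eq_integral (by linarith), add_sub_cancel_right]
  refine h.congr' ?_
  filter_upwards [eventually_ge_atTop 0] with w hw
  rw [id, intervalIntegral.integral_of_le hw]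

/-- The primitive `∫₀ˢ ∫₀ʷ e^{-z} z^m dz dw` of the incomplete Gamma function. -/
noncomputable def lowerGammaIntegral (m S : ℝ) : ℝ :=
  (∫⁻ w in Set.Ioc 0 S, lowerGamma m w).toReal

theorem lintegral_lowerGamma_le (hm : 0 ≤ m) {S : ℝ} (hS : 0 ≤ S) :
    ∫⁻ w in Set.Ioc 0 S, lowerGamma m w ≤ ENNReal.ofReal (Real.Gamma (m + 1) * S) := by
  calc _ ≤ ∫⁻ _ in Set.Ioc 0 S, ENNReal.ofReal (Real.Gamma (m + 1)) :=
        lintegral_mono fun w => lowerGamma_le hm w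
    _ = _ := by
        rw [lintegral_const, Measure.restrict_apply_univ, Real.volume_Ioc, sub_zero,
          ENNReal.ofReal_mul' hS]

theorem ofReal_lowerGammaIntegral (hm : 0 ≤ m) {S : ℝ} (hS : 0 ≤ S) :
    ENNReal.ofReal (lowerGammaIntegral m S) = ∫⁻ w in Set.Ioc 0 S, lowerGamma m w :=
  ENNReal.ofReal_toReal (ne_top_of_le_ne_top ENNReal.ofReal_ne_top (lintegral_lowerGamma_le hm hS))

theorem tendsto_lowerGammaIntegral_div (hm : 0 ≤ m) :
    Tendsto (fun S => lowerGammaIntegral m S / S) atTop (𝓝 (Real.Gamma (m + 1))) := by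
  have hΓ : 0 < Real.Gamma (m + 1) := Real.Gamma_pos_of_pos (by linarith)
  refine tendsto_order.2 ⟨fun a ha => ?_, fun a ha => ?_⟩
  · obtain ⟨a', ha1, ha2⟩ := exists_between ha
    obtain ⟨w₀, hw₀, hw₀'⟩ := (((tendsto_integral_Ioc_Gamma hm).eventually_const_lt ha2).and
      (eventually_ge_atTop 0)).exists
    have hlim : Tendsto (fun S : ℝ => a' * (1 - w₀ / S)) atTop (𝓝 (a' * (1 - 0))) :=
      (tendsto_const_nhds.sub (tendsto_const_nhds.div_atTop tendsto_id)).const_mul a'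
    rw [sub_zero, mul_one] at hlim
    filter_upwards [hlim.eventually_const_lt ha1, eventually_ge_atTop w₀, eventually_gt_atTop 0]
      with S h1 h2 h3
    refine h1.trans_le ?_
    rw [le_div_iff₀ h3, mul_assoc, sub_mul, one_mul, div_mul_cancel₀ _ h3.ne']
    by_cases hneg : a' ≤ 0
    · exact (mul_nonpos_of_nonpos_of_nonneg hneg (by linarith)).trans ENNReal.toReal_nonneg
    · rw [← ENNReal.ofReal_le_ofReal_iff (q := lowerGammaIntegral m S)
        ENNReal.toReal_nonneg, ofReal_lowerGammaIntegral hm h3.le]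
      calc ENNReal.ofReal (a' * (S - w₀)) = ∫⁻ _ in Set.Ioc w₀ S, ENNReal.ofReal a' := by
            rw [lintegral_const, Measure.restrict_apply_univ, Real.volume_Ioc,
              ENNReal.ofReal_mul' (by linarith)]
        _ ≤ ∫⁻ w in Set.Ioc w₀ S, lowerGamma m w := by
            refine setLIntegral_mono' measurableSet_Ioc fun w hw => ?_
            refine le_trans ?_ (lowerGamma_mono m hw.1.le)
            rw [lowerGamma_eq_ofReal hm]
            exact ENNReal.ofReal_le_ofReal hw₀.le
        _ ≤ _ := lintegral_mono_set (Set.Ioc_subset_Ioc_left hw₀')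
  · filter_upwards [eventually_gt_atTop 0] with S hS
    refine lt_of_le_of_lt ?_ ha
    rw [div_le_iff₀ hS]
    exact ENNReal.toReal_le_of_le_ofReal (by positivity) (lintegral_lowerGamma_le hm hS.le)

end IncompleteGamma

section Tail

theorem tendsto_rpow_mul_exp_neg_mul_rpow {β γ : ℝ} (hβ : 0 < β) (hγ : 0 < γ) (q : ℝ) :
    Tendsto (fun r : ℝ => r ^ q * Real.exp (-(β * r ^ γ))) atTop (𝓝 0) := by
  have h := (tendsto_rpow_mul_exp_neg_mul_atTop_nhds_zero (q / γ) β hβ).comp (tendsto_rpow_atTop hγ)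
  refine h.congr' ?_
  filter_upwards [eventually_gt_atTop 0] with r hr
  rw [Function.comp_apply, ← Real.rpow_mul hr.le, mul_div_cancel₀ _ hγ.ne', neg_mul]

/-- Comparison of the tail integral with an explicit primitive. -/
theorem eventually_lintegral_rpow_mul_exp_le {β γ : ℝ} (hβ : 0 < β) (hγ : 0 < γ) (q : ℝ) :
    ∀ᶠ B in atTop, ∫⁻ r in Set.Ioi B, ENNReal.ofReal (r ^ q * Real.exp (-(β * r ^ γ))) ≤
      ENNReal.ofReal (2 / (β * γ) * (B ^ (q + 1 - γ) * Real.exp (-(β * B ^ γ)))) := by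
  set κ := q + 1 - γ with hκ
  filter_upwards [eventually_gt_atTop 0, ((tendsto_rpow_atTop hγ).const_mul_atTop
    (mul_pos hβ hγ)).eventually_ge_atTop (2 * κ)] with B hB hB2
  have hder : ∀ r ∈ Set.Ici B, HasDerivAt
      (fun r : ℝ => -(2 / (β * γ) * (r ^ κ * Real.exp (-(β * r ^ γ)))))
      (2 / (β * γ) * ((β * γ * r ^ γ - κ) * r ^ (κ - 1) * Real.exp (-(β * r ^ γ)))) r := by
    intro r hr
    have hr0 : 0 < r := hB.trans_le hr
    have h1 := Real.hasDerivAt_rpow_const (x := r) (p := κ) (Or.inl hr0.ne')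
    have h2 := (((Real.hasDerivAt_rpow_const (x := r) (p := γ) (Or.inl hr0.ne')).const_mul
      β).neg).exp
    convert! ((h1.mul h2).const_mul (2 / (β * γ))).neg using 1
    have e1 : r ^ κ = r * r ^ (κ - 1) := by
      rw [Real.rpow_sub_one hr0.ne']; field_simp
    have e2 : r ^ γ = r * r ^ (γ - 1) := by
      rw [Real.rpow_sub_one hr0.ne']; field_simp
    rw [Pi.neg_apply, e1]
    generalize Real.exp (-(β * r ^ γ)) = E
    rw [e2]
    ring
  have hlow : ∀ r ∈ Set.Ioi B, r ^ q * Real.exp (-(β * r ^ γ)) ≤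
      2 / (β * γ) * ((β * γ * r ^ γ - κ) * r ^ (κ - 1) * Real.exp (-(β * r ^ γ))) := by
    intro r hr
    have hr0 : 0 < r := hB.trans hr
    have h1 : 2 * κ ≤ β * γ * r ^ γ := hB2.trans (by gcongr; exact le_of_lt hr)
    have h2 : β * γ * r ^ γ / 2 ≤ β * γ * r ^ γ - κ := by linarith
    have h3 : r ^ q = r ^ γ * r ^ (κ - 1) := by
      rw [← Real.rpow_add hr0]; congr 1; rw [hκ]; ring
    calc r ^ q * Real.exp (-(β * r ^ γ))
        = 2 / (β * γ) * (β * γ * r ^ γ / 2 * r ^ (κ - 1) * Real.exp (-(β * r ^ γ))) := by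
          rw [h3]; field_simp
      _ ≤ _ := by gcongr
  have hpos : ∀ r ∈ Set.Ioi B, 0 ≤
      2 / (β * γ) * ((β * γ * r ^ γ - κ) * r ^ (κ - 1) * Real.exp (-(β * r ^ γ))) := fun r hr =>
    le_trans (mul_nonneg (Real.rpow_nonneg (hB.trans hr).le _) (Real.exp_pos _).le) (hlow r hr)
  have hlim : Tendsto (fun r : ℝ => -(2 / (β * γ) * (r ^ κ * Real.exp (-(β * r ^ γ))))) atTop
      (𝓝 0) := by
    simpa using ((tendsto_rpow_mul_exp_neg_mul_rpow hβ hγ κ).const_mul (2 / (β * γ))).neg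
  have hint := integrableOn_Ioi_deriv_of_nonneg' hder hpos hlim
  have hval := integral_Ioi_of_hasDerivAt_of_nonneg' hder hpos hlim
  rw [zero_sub, neg_neg] at hval
  rw [← hval, ofReal_integral_eq_lintegral_ofReal hint
    ((ae_restrict_iff' measurableSet_Ioi).2 (Eventually.of_forall hpos))]
  exact setLIntegral_mono' measurableSet_Ioi fun r hr => ENNReal.ofReal_le_ofReal (hlow r hr)

/-- The tail of a distribution with a density of order `|x|^α e^{-β |x|^γ}`. -/
theorem exists_withDensity_tail_le (k : ℕ) {f : EuclideanSpace ℝ (Fin (k + 1)) → ℝ} {c α β γ : ℝ}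
    (hc : 0 < c) (hβ : 0 < β) (hγ : 0 < γ)
    (hf : f ~[Bornology.cobounded (EuclideanSpace ℝ (Fin (k + 1)))]
      fun x => c * ‖x‖ ^ α * Real.exp (-(β * ‖x‖ ^ γ))) :
    ∃ C ≥ 0, ∀ᶠ B in atTop,
      (volume.withDensity fun x => ENNReal.ofReal (f x)) {x | B < ‖x‖} ≤
        ENNReal.ofReal (C * (B ^ (α + k + 1 - γ) * Real.exp (-(β * B ^ γ)))) := by
  have hω : 0 ≤ unitSphereArea k := measureReal_nonneg
  refine ⟨unitSphereArea k * (2 * c) * (2 / (β * γ)), by positivity, ?_⟩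
  have hf2 : ∀ᶠ x in Bornology.cobounded (EuclideanSpace ℝ (Fin (k + 1))),
      f x ≤ 2 * (c * ‖x‖ ^ α * Real.exp (-(β * ‖x‖ ^ γ))) := by
    filter_upwards [hf.isLittleO.bound one_pos] with x hx
    rw [one_mul, Pi.sub_apply, Real.norm_eq_abs, Real.norm_of_nonneg (by positivity)] at hx
    linarith [le_abs_self (f x - c * ‖x‖ ^ α * Real.exp (-(β * ‖x‖ ^ γ)))]
  rw [← comap_norm_atTop, eventually_comap, eventually_atTop] at hf2
  obtain ⟨R, hR⟩ := hf2
  filter_upwards [eventually_lintegral_rpow_mul_exp_le hβ hγ (α + k), eventually_ge_atTop R,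
    eventually_gt_atTop 0] with B hB hBR hB0
  have hm : MeasurableSet {x : EuclideanSpace ℝ (Fin (k + 1)) | ‖x‖ ∈ Set.Ioi B} :=
    measurable_norm measurableSet_Ioi
  change (volume.withDensity fun x => ENNReal.ofReal (f x))
    {x : EuclideanSpace ℝ (Fin (k + 1)) | ‖x‖ ∈ Set.Ioi B} ≤ _
  rw [withDensity_apply _ hm]
  calc _ ≤ ∫⁻ x in {x : EuclideanSpace ℝ (Fin (k + 1)) | ‖x‖ ∈ Set.Ioi B},
        ENNReal.ofReal (2 * (c * ‖x‖ ^ α * Real.exp (-(β * ‖x‖ ^ γ)))) :=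
        setLIntegral_mono' hm fun x hx => ENNReal.ofReal_le_ofReal
          (hR ‖x‖ (hBR.trans (le_of_lt hx)) x rfl)
    _ = ENNReal.ofReal (unitSphereArea k) * ∫⁻ r in Set.Ioi B, ENNReal.ofReal (r ^ k) *
          ENNReal.ofReal (2 * (c * r ^ α * Real.exp (-(β * r ^ γ)))) :=
        setLIntegral_norm_eq k
          (φ := fun r => ENNReal.ofReal (2 * (c * r ^ α * Real.exp (-(β * r ^ γ)))))
          (by fun_prop) measurableSet_Ioi fun r (hr : B < r) => hB0.trans hr
    _ = ENNReal.ofReal (unitSphereArea k) * (ENNReal.ofReal (2 * c) * ∫⁻ r in Set.Ioi B,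
          ENNReal.ofReal (r ^ (α + k) * Real.exp (-(β * r ^ γ)))) := by
        congr 1
        rw [← lintegral_const_mul' _ _ ENNReal.ofReal_ne_top]
        refine setLIntegral_congr_fun measurableSet_Ioi fun r hr => ?_
        have hr0 : 0 < r := hB0.trans hr
        rw [← ENNReal.ofReal_mul (by positivity), ← ENNReal.ofReal_mul (by positivity),
          Real.rpow_add hr0, Real.rpow_natCast]
        congr 1
        ring
    _ ≤ ENNReal.ofReal (unitSphereArea k) * (ENNReal.ofReal (2 * c) * ENNReal.ofReal
          (2 / (β * γ) * (B ^ (α + k + 1 - γ) * Real.exp (-(β * B ^ γ))))) := by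
        gcongr
    _ = _ := by
        rw [← ENNReal.ofReal_mul (by positivity), ← ENNReal.ofReal_mul hω]
        congr 1
        ring

end Tail

/-! ### The scales of the problem -/

/-- The parameters of the problem in dimension `k + 1`: a density asymptotic to
`c |x|^α e^{-β |x|^γ}`, and the constant term `C` of the centring. The sample size is written as
`e^N`, and all scales are functions of the real variable `N`. -/
structure PairScaling where
  /-- The dimension minus one. -/
  k : ℕ
  /-- The constant factor of the density. -/
  c : ℝ
  /-- The power in the density. -/
  α : ℝ
  /-- The rate in the exponential factor of the density. -/
  β : ℝ
  /-- The power in the exponential factor of the density. -/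
  γ : ℝ
  /-- The constant term of the centring. -/
  C : ℝ
  k_pos : 0 < k
  c_pos : 0 < c
  β_pos : 0 < β
  γ_pos : 0 < γ

namespace PairScaling

variable (p : PairScaling)

/-- The exponent `m = (d - 1) / 2` governing the measure of small spherical caps. -/
noncomputable def capExp : ℝ := (p.k : ℝ) / 2

/-- The exponent of `N` in the intensity of points at distance about `radius N`. -/
noncomputable def intensityExp : ℝ := (p.α + p.k + 1) / p.γ - 1

/-- The coefficient of `log N` in the centring. -/
noncomputable def centringExp : ℝ := 2 * ((p.α + p.k + 1) / p.γ) - ((p.k : ℝ) + 4) / 2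

/-- The radius `b` with `β b ^ γ = N`, around which the extreme points are found. -/
noncomputable def radius (N : ℝ) : ℝ := (N / p.β) ^ (1 / p.γ)

/-- The scale of the fluctuations of the largest norm. -/
noncomputable def unit (N : ℝ) : ℝ := p.radius N / (p.γ * N)

/-- The rescaled threshold for the interpoint distance. -/
noncomputable def level (N : ℝ) : ℝ := p.centringExp * Real.log N + Real.log (Real.log N) + p.C

/-- The threshold for the interpoint distance. -/
noncomputable def threshold (N : ℝ) : ℝ := 2 * p.radius N + p.unit N * p.level N

/-- The factor `D` such that `D e^{-u} du`, times the area of the unit sphere, approximates the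
expected number of points with norm in `radius N + unit N * [u, u + du]`. -/
noncomputable def intensity (N : ℝ) : ℝ := p.c * p.radius N ^ (p.α + p.k) * p.unit N

/-- The rescaled truncation level. The first term makes the expected number of points beyond it of
order one, the second makes it tend to zero, but so slowly that the truncation does not affect the
number of far pairs. -/
noncomputable def cutoffLevel (N : ℝ) : ℝ :=
  Real.log (p.intensity N) + 1 / 2 * Real.log (Real.log N)

/-- The truncation radius, which no point of the sample exceeds with high probability. -/
noncomputable def cutoff (N : ℝ) : ℝ := p.radius N + p.unit N * p.cutoffLevel N

/-- The rescaled length of the range of norms of points that belong to far pairs. -/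
noncomputable def range (N : ℝ) : ℝ := 2 * p.cutoffLevel N - p.level N

/-- The factor of the measure of spherical caps. -/
noncomputable def capFactor (N : ℝ) : ℝ := unitBallVolume p.k * (4 / (p.γ * N)) ^ p.capExp

/-- The constant of `intensity`. -/
noncomputable def intensityConst : ℝ := p.c * p.γ⁻¹ * p.β ^ (-((p.α + p.k + 1) / p.γ))

/-- The constant in the asymptotics of the expected number of far pairs. -/
noncomputable def pairConst : ℝ :=
  p.intensityConst ^ 2 * (unitBallVolume p.k * (4 / p.γ) ^ p.capExp) * Real.exp (-p.C)

theorem capExp_pos : 0 < p.capExp := by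
  have := p.k_pos
  unfold capExp
  positivity

theorem unitBallVolume_pos (k : ℕ) : 0 < unitBallVolume k :=
  ENNReal.toReal_pos (Metric.measure_ball_pos _ _ one_pos).ne' measure_ball_lt_top.ne

theorem unitSphereArea_pos (k : ℕ) : 0 < unitSphereArea k := by
  rw [unitSphereArea, Measure.toSphere_real_apply_univ, finrank_euclideanSpace_fin]
  exact mul_pos (by positivity)
    (ENNReal.toReal_pos (Metric.measure_ball_pos _ _ one_pos).ne' measure_ball_lt_top.ne)

variable {N : ℝ}

theorem radius_pos (hN : 0 < N) : 0 < p.radius N := Real.rpow_pos_of_pos (div_pos hN p.β_pos) _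

theorem unit_pos (hN : 0 < N) : 0 < p.unit N :=
  div_pos (p.radius_pos hN) (mul_pos p.γ_pos hN)

theorem intensity_pos (hN : 0 < N) : 0 < p.intensity N :=
  mul_pos (mul_pos p.c_pos (Real.rpow_pos_of_pos (p.radius_pos hN) _)) (p.unit_pos hN)

theorem capFactor_pos (hN : 0 < N) : 0 < p.capFactor N :=
  mul_pos (unitBallVolume_pos _)
    (Real.rpow_pos_of_pos (div_pos (by norm_num) (mul_pos p.γ_pos hN)) _)

theorem intensityConst_pos : 0 < p.intensityConst :=
  mul_pos (mul_pos p.c_pos (inv_pos.2 p.γ_pos)) (Real.rpow_pos_of_pos p.β_pos _)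

theorem mul_radius_rpow (hN : 0 < N) : p.β * p.radius N ^ p.γ = N := by
  have := p.β_pos
  have := p.γ_pos
  rw [radius, ← Real.rpow_mul (by positivity), one_div_mul_cancel p.γ_pos.ne', Real.rpow_one]
  field_simp

theorem radius_rpow (hN : 0 < N) (q : ℝ) : p.radius N ^ q = N ^ (q / p.γ) * p.β ^ (-(q / p.γ)) := by
  have := p.β_pos
  rw [radius, ← Real.rpow_mul (by positivity), one_div_mul_eq_div, Real.div_rpow hN.le p.β_pos.le,
    Real.rpow_neg p.β_pos.le]
  rfl

theorem intensity_eq (hN : 0 < N) : p.intensity N = p.intensityConst * N ^ p.intensityExp := by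
  have hb := p.radius_pos hN
  have hγ := p.γ_pos
  have h1 : p.radius N ^ (p.α + p.k) * p.radius N = p.radius N ^ (p.α + p.k + 1) := by
    rw [Real.rpow_add_one hb.ne']
  rw [intensity, unit, mul_assoc, ← mul_div_assoc, h1, radius_rpow p hN, intensityConst,
    intensityExp, Real.rpow_sub_one hN.ne']
  field_simp

theorem log_intensity (hN : 0 < N) :
    Real.log (p.intensity N) = Real.log p.intensityConst + p.intensityExp * Real.log N := by
  rw [intensity_eq p hN, Real.log_mul p.intensityConst_pos.ne' (Real.rpow_pos_of_pos hN _).ne',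
    Real.log_rpow hN]

theorem radius_div_unit (hN : 0 < N) : p.radius N / p.unit N = p.γ * N := by
  have := p.radius_pos hN
  have := p.γ_pos
  rw [unit]
  field_simp

theorem threshold_div_unit (hN : 0 < N) : p.threshold N / p.unit N = 2 * (p.γ * N) + p.level N := by
  have h := p.unit_pos hN
  rw [← radius_div_unit p hN, threshold]
  field_simp

theorem threshold_eq (N : ℝ) :
    p.threshold N = p.radius N * (2 + p.level N / (p.γ * N)) := by
  rw [threshold, unit]
  ring

theorem range_eq (hN : 0 < N) : (2 * p.cutoff N - p.threshold N) / p.unit N = p.range N := by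
  have h := p.unit_pos hN
  rw [cutoff, threshold, range]
  field_simp
  ring

theorem exp_cutoffLevel (hN : 1 < N) :
    Real.exp (p.cutoffLevel N) = p.intensity N * Real.log N ^ (1 / 2 : ℝ) := by
  rw [cutoffLevel, Real.exp_add, Real.exp_log (p.intensity_pos (by linarith)),
    Real.rpow_def_of_pos (Real.log_pos hN), mul_comm (1 / 2 : ℝ)]

/-- The powers of `N` in the expected number of far pairs cancel. -/
theorem pairs_eq (hN : 1 < N) :
    p.intensity N ^ 2 * p.capFactor N * Real.exp (-p.level N) = p.pairConst / Real.log N := by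
  have hN0 : 0 < N := by linarith
  have hγ := p.γ_pos
  have hl := Real.log_pos hN
  have e1 : Real.exp (-p.level N) = N ^ (-p.centringExp) * (Real.log N)⁻¹ * Real.exp (-p.C) := by
    rw [level, show -(p.centringExp * Real.log N + Real.log (Real.log N) + p.C) =
      Real.log N * -p.centringExp + -Real.log (Real.log N) + -p.C by ring, Real.exp_add,
      Real.exp_add, Real.rpow_def_of_pos hN0, Real.exp_neg (Real.log _), Real.exp_log hl]
  have e2 : (4 / (p.γ * N)) ^ p.capExp = (4 / p.γ) ^ p.capExp * N ^ (-p.capExp) := by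
    rw [← div_div, Real.div_rpow (by positivity) hN0.le, Real.rpow_neg hN0.le]
    rfl
  have e3 : (N ^ p.intensityExp) ^ 2 * N ^ (-p.capExp) * N ^ (-p.centringExp) = 1 := by
    rw [← Real.rpow_natCast, ← Real.rpow_mul hN0.le, ← Real.rpow_add hN0, ← Real.rpow_add hN0]
    have : p.intensityExp * ((2 : ℕ) : ℝ) + -p.capExp + -p.centringExp = 0 := by
      rw [intensityExp, capExp, centringExp]
      push_cast
      ring
    rw [this, Real.rpow_zero]
  rw [intensity_eq p hN0, capFactor, e1, e2, pairConst]
  calc _ = p.intensityConst ^ 2 * (unitBallVolume p.k * (4 / p.γ) ^ p.capExp) * Real.exp (-p.C) *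
        (Real.log N)⁻¹ * ((N ^ p.intensityExp) ^ 2 * N ^ (-p.capExp) * N ^ (-p.centringExp)) := by
        ring
    _ = _ := by rw [e3, mul_one]; rfl

theorem tendsto_log_log_div_log :
    Tendsto (fun N : ℝ => Real.log (Real.log N) / Real.log N) atTop (𝓝 0) :=
  (Real.isLittleO_log_id_atTop.tendsto_div_nhds_zero).comp Real.tendsto_log_atTop

theorem tendsto_level_div_log :
    Tendsto (fun N => p.level N / Real.log N) atTop (𝓝 p.centringExp) := by
  have h := (tendsto_log_log_div_log.const_add p.centringExp).add
    (tendsto_const_nhds (x := p.C).div_atTop Real.tendsto_log_atTop)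
  simp only [add_zero] at h
  refine h.congr' ?_
  filter_upwards [eventually_gt_atTop 1] with N hN
  have := Real.log_pos hN
  rw [level]
  field_simp

theorem tendsto_cutoffLevel_div_log :
    Tendsto (fun N => p.cutoffLevel N / Real.log N) atTop (𝓝 p.intensityExp) := by
  have h := ((tendsto_log_log_div_log.const_mul (1 / 2)).const_add p.intensityExp).add
    (tendsto_const_nhds (x := Real.log p.intensityConst).div_atTop Real.tendsto_log_atTop)
  simp only [add_zero, mul_zero] at h
  refine h.congr' ?_
  filter_upwards [eventually_gt_atTop 1] with N hN
  have := Real.log_pos hN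
  rw [cutoffLevel, log_intensity p (by linarith)]
  field_simp
  ring

theorem tendsto_range_div_log :
    Tendsto (fun N => p.range N / Real.log N) atTop (𝓝 p.capExp) := by
  have h := (p.tendsto_cutoffLevel_div_log.const_mul 2).sub p.tendsto_level_div_log
  have e : 2 * p.intensityExp - p.centringExp = p.capExp := by
    rw [intensityExp, capExp, centringExp]; ring
  rw [e] at h
  refine h.congr fun N => ?_
  rw [range]
  ring

theorem tendsto_range : Tendsto p.range atTop atTop := by
  have h := p.tendsto_range_div_log.pos_mul_atTop p.capExp_pos Real.tendsto_log_atTop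
  refine h.congr' ?_
  filter_upwards [eventually_gt_atTop 1] with N hN
  exact div_mul_cancel₀ _ (Real.log_pos hN).ne'

/-- A bound for the rescaled deviations from `radius N` of the norms of points in far pairs. -/
noncomputable def spread (N : ℝ) : ℝ := |p.level N| + |p.cutoffLevel N|

theorem tendsto_spread_sq_div : Tendsto (fun N => p.spread N ^ 2 / N) atTop (𝓝 0) := by
  have h1 := (p.tendsto_level_div_log.abs.add p.tendsto_cutoffLevel_div_log.abs).pow 2
  have h2 : Tendsto (fun N : ℝ => Real.log N ^ 2 / N) atTop (𝓝 0) :=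
    (Real.isLittleO_pow_log_id_atTop (n := 2)).tendsto_div_nhds_zero
  have h := h1.mul h2
  rw [mul_zero] at h
  refine h.congr' ?_
  filter_upwards [eventually_gt_atTop 1] with N hN
  have hl := Real.log_pos hN
  rw [abs_div, abs_div, abs_of_pos hl, spread]
  field_simp

theorem tendsto_spread_div : Tendsto (fun N => p.spread N / N) atTop (𝓝 0) := by
  have h1 := p.tendsto_level_div_log.abs.add p.tendsto_cutoffLevel_div_log.abs
  have h2 : Tendsto (fun N : ℝ => Real.log N / N) atTop (𝓝 0) :=
    Real.isLittleO_log_id_atTop.tendsto_div_nhds_zero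
  have h := h1.mul h2
  rw [mul_zero] at h
  refine h.congr' ?_
  filter_upwards [eventually_gt_atTop 1] with N hN
  have hl := Real.log_pos hN
  rw [abs_div, abs_div, abs_of_pos hl, spread]
  field_simp

theorem tendsto_radius : Tendsto p.radius atTop atTop :=
  (tendsto_rpow_atTop (one_div_pos.2 p.γ_pos)).comp (tendsto_id.atTop_div_const p.β_pos)

/-- The norms of points in far pairs are `radius N * (1 + h)` with `h` and `N h ^ 2` uniformly
small. -/
theorem eventually_small_deviation {η : ℝ} (hη : 0 < η) :
    ∀ᶠ N in atTop, 0 < N ∧ |p.level N / (p.γ * N)| ≤ η ∧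
      ∀ r ∈ Set.Ioc (p.threshold N - p.cutoff N) (p.cutoff N),
        |r / p.radius N - 1| ≤ η ∧ N * (r / p.radius N - 1) ^ 2 ≤ η := by
  have hγ := p.γ_pos
  have h1 := (p.tendsto_spread_div.div_const p.γ)
  have h2 := (p.tendsto_spread_sq_div.div_const (p.γ ^ 2))
  rw [zero_div] at h1 h2
  filter_upwards [eventually_gt_atTop 0, h1.eventually (ge_mem_nhds hη),
    h2.eventually (ge_mem_nhds hη)] with N hN hN1 hN2
  have hb := p.radius_pos hN
  have hδ := p.unit_pos hN
  have hγN : 0 < p.γ * N := by positivity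
  have e1 : p.spread N / N / p.γ = p.spread N / (p.γ * N) := by
    rw [div_div, mul_comm]
  rw [e1] at hN1
  refine ⟨hN, ?_, fun r hr => ?_⟩
  · rw [abs_div, abs_of_pos hγN]
    refine le_trans ?_ hN1
    gcongr
    exact le_add_of_nonneg_right (abs_nonneg _)
  · have hu : |(r - p.radius N) / p.unit N| ≤ p.spread N := by
      obtain ⟨h1, h2⟩ := hr
      rw [cutoff] at h1 h2
      rw [threshold] at h1
      rw [abs_le, spread]
      have hA := neg_abs_le (p.level N)
      have hB := le_abs_self (p.cutoffLevel N)
      have hA' := abs_nonneg (p.level N)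
      constructor
      · rw [le_div_iff₀ hδ]
        nlinarith
      · rw [div_le_iff₀ hδ]
        nlinarith
    have e2 : r / p.radius N - 1 = (r - p.radius N) / p.unit N / (p.γ * N) := by
      rw [unit]
      field_simp
    rw [e2]
    constructor
    · rw [abs_div, abs_of_pos hγN]
      exact le_trans (by gcongr) hN1
    · refine le_trans (le_of_eq_of_le ?_ (div_le_div_of_nonneg_right
        (div_le_div_of_nonneg_right (sq_le_sq' (neg_le_of_abs_le hu) (le_of_abs_le hu)) hN.le)
        (sq_nonneg p.γ))) hN2
      field_simp

theorem tendsto_threshold_sub_cutoff :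
    Tendsto (fun N => p.threshold N - p.cutoff N) atTop atTop := by
  refine tendsto_atTop_mono' _ ?_ (p.tendsto_radius.atTop_div_const two_pos)
  have h1 := (p.tendsto_spread_div.div_const p.γ)
  rw [zero_div] at h1
  filter_upwards [eventually_gt_atTop 0, h1.eventually (ge_mem_nhds (one_half_pos))] with N hN hN1
  have hb := p.radius_pos hN
  have hγ := p.γ_pos
  rw [threshold, cutoff]
  have h2 : -(p.spread N) ≤ p.level N - p.cutoffLevel N := by
    rw [spread]
    linarith [neg_abs_le (p.level N), le_abs_self (p.cutoffLevel N)]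
  have h3 : p.unit N * p.spread N ≤ p.radius N / 2 := by
    calc p.unit N * p.spread N = p.radius N * (p.spread N / N / p.γ) := by
          rw [unit]; field_simp
      _ ≤ p.radius N * (1 / 2) := by gcongr
      _ = _ := by ring
  have h4 := mul_le_mul_of_nonneg_left h2 (p.unit_pos hN).le
  rw [mul_neg, mul_sub] at h4
  linarith

end PairScaling

/-! ### Asymptotics of the far pairs -/

namespace PairScaling

variable (p : PairScaling) {f : EuclideanSpace ℝ (Fin (p.k + 1)) → ℝ}

/-- In the relevant range of norms, the density is approximately exponential in the radius. -/
theorem eventually_density_bounds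
    (hf : f ~[Bornology.cobounded (EuclideanSpace ℝ (Fin (p.k + 1)))]
      fun x => p.c * ‖x‖ ^ p.α * Real.exp (-(p.β * ‖x‖ ^ p.γ)))
    {ε : ℝ} (hε : 0 < ε) (hε1 : ε ≤ 1) :
    ∀ᶠ N in atTop, ∀ y : EuclideanSpace ℝ (Fin (p.k + 1)),
      ‖y‖ ∈ Set.Ioc (p.threshold N - p.cutoff N) (p.cutoff N) →
      (1 - ε) * (p.intensity N * Real.exp (p.γ * N) * Real.exp (-(‖y‖ / p.unit N))) ≤
          Real.exp N * p.unit N * ‖y‖ ^ p.k * f y ∧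
        Real.exp N * p.unit N * ‖y‖ ^ p.k * f y ≤
          (1 + ε) * (p.intensity N * Real.exp (p.γ * N) * Real.exp (-(‖y‖ / p.unit N))) := by
  obtain ⟨η, hη, hexp⟩ := exists_abs_rpow_mul_exp_sub_one_le (p.α + p.k) p.γ
    (ε := ε / 3) (by positivity)
  have hf1 : ∀ᶠ x in Bornology.cobounded (EuclideanSpace ℝ (Fin (p.k + 1))),
      |f x - p.c * ‖x‖ ^ p.α * Real.exp (-(p.β * ‖x‖ ^ p.γ))| ≤
        ε / 3 * (p.c * ‖x‖ ^ p.α * Real.exp (-(p.β * ‖x‖ ^ p.γ))) := by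
    have hc := p.c_pos
    filter_upwards [hf.isLittleO.bound (c := ε / 3) (by positivity)] with x hx
    rwa [Pi.sub_apply, Real.norm_eq_abs, Real.norm_of_nonneg (by positivity)] at hx
  rw [← comap_norm_atTop, eventually_comap, eventually_atTop] at hf1
  obtain ⟨R, hR⟩ := hf1
  filter_upwards [p.eventually_small_deviation hη,
    p.tendsto_threshold_sub_cutoff.eventually_ge_atTop R,
    p.tendsto_threshold_sub_cutoff.eventually_ge_atTop 0] with N hN hNR hN0 y hy
  obtain ⟨hNpos, -, hdev⟩ := hN
  obtain ⟨d1, d2⟩ := hdev _ hy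
  have hfy := hR ‖y‖ (hNR.trans hy.1.le) y rfl
  have hb := p.radius_pos hNpos
  have hδ := p.unit_pos hNpos
  have hc := p.c_pos
  have hγ := p.γ_pos
  have hy0 : 0 < ‖y‖ := hN0.trans_lt hy.1
  set g := p.c * ‖y‖ ^ p.α * Real.exp (-(p.β * ‖y‖ ^ p.γ)) with hg
  have hg0 : 0 < g := by positivity
  set h := ‖y‖ / p.radius N - 1 with hh
  have hyh : ‖y‖ = p.radius N * (1 + h) := by rw [hh]; field_simp; ring
  have h1h : 0 < 1 + h := by rw [hh]; simp; positivity
  have hE := hexp N h hNpos.le d1 d2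
  set E := (1 + h) ^ (p.α + p.k) * Real.exp (-(N * ((1 + h) ^ p.γ - 1 - p.γ * h))) with hEdef
  set G := p.intensity N * Real.exp (p.γ * N) * Real.exp (-(‖y‖ / p.unit N)) with hG
  have hG0 : 0 < G := by
    have := p.intensity_pos hNpos
    positivity
  have key : Real.exp N * p.unit N * ‖y‖ ^ p.k * g = G * E := by
    have e1 : ‖y‖ ^ p.k * ‖y‖ ^ p.α = p.radius N ^ (p.α + p.k) * (1 + h) ^ (p.α + p.k) := by
      rw [← Real.mul_rpow hb.le h1h.le, ← hyh, Real.rpow_add hy0, Real.rpow_natCast, mul_comm]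
    have e2 : p.β * ‖y‖ ^ p.γ = N * (1 + h) ^ p.γ := by
      rw [hyh, Real.mul_rpow hb.le h1h.le, ← mul_assoc, p.mul_radius_rpow hNpos]
    have e3 : ‖y‖ / p.unit N = p.γ * N * (1 + h) := by
      rw [hyh, mul_div_right_comm, p.radius_div_unit hNpos]
    have e4 : Real.exp N * Real.exp (-(N * (1 + h) ^ p.γ)) = Real.exp (p.γ * N) *
        Real.exp (-(p.γ * N * (1 + h))) * Real.exp (-(N * ((1 + h) ^ p.γ - 1 - p.γ * h))) := by
      rw [← Real.exp_add, ← Real.exp_add, ← Real.exp_add]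
      congr 1
      ring
    rw [hg, hG, hEdef, e2, e3, intensity]
    calc _ = p.c * p.unit N * (‖y‖ ^ p.k * ‖y‖ ^ p.α) *
          (Real.exp N * Real.exp (-(N * (1 + h) ^ p.γ))) := by ring
      _ = _ := by rw [e1, e4]; ring
  set w := Real.exp N * p.unit N * ‖y‖ ^ p.k with hw
  have hw0 : 0 < w := by positivity
  obtain ⟨a1, a2⟩ := abs_le.1 hfy
  obtain ⟨b1, b2⟩ := abs_le.1 hE
  have c1 : (1 - ε / 3) * (G * E) ≤ w * f y := by
    rw [← key]
    calc _ = w * (g - ε / 3 * g) := by ring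
      _ ≤ w * f y := by gcongr; linarith
  have c2 : w * f y ≤ (1 + ε / 3) * (G * E) := by
    rw [← key]
    calc w * f y ≤ w * (g + ε / 3 * g) := by gcongr; linarith
      _ = _ := by ring
  have b1' : 1 - ε / 3 ≤ E := by linarith
  have b2' : E ≤ 1 + ε / 3 := by linarith
  constructor
  · refine le_trans ?_ c1
    calc (1 - ε) * G ≤ (1 - ε / 3) * (G * (1 - ε / 3)) := by
          have : 1 - ε ≤ (1 - ε / 3) * (1 - ε / 3) := by nlinarith
          calc _ ≤ (1 - ε / 3) * (1 - ε / 3) * G := by gcongr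
            _ = _ := by ring
      _ ≤ _ := by
          have : 0 ≤ 1 - ε / 3 := by linarith
          gcongr
  · refine c2.trans ?_
    calc (1 + ε / 3) * (G * E) ≤ (1 + ε / 3) * (G * (1 + ε / 3)) := by gcongr
      _ = (1 + ε / 3) * (1 + ε / 3) * G := by ring
      _ ≤ (1 + ε) * G := by
          have : (1 + ε / 3) * (1 + ε / 3) ≤ 1 + ε := by nlinarith
          gcongr

/-- In the relevant range of norms, two points are far apart with the probability that their
directions are opposite up to a small angle. -/
theorem eventually_toSphere_bounds {ε : ℝ} (hε : 0 < ε) :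
    ∀ᶠ N in atTop, ∀ (x : EuclideanSpace ℝ (Fin (p.k + 1))) (s : ℝ),
      ‖x‖ ∈ Set.Ioc (p.threshold N - p.cutoff N) (p.cutoff N) →
      s ∈ Set.Ioc (p.threshold N - ‖x‖) (p.cutoff N) →
      ENNReal.ofReal ((1 - ε) *
          (p.capFactor N * ((s - (p.threshold N - ‖x‖)) / p.unit N) ^ p.capExp)) ≤
        (volume : Measure (EuclideanSpace ℝ (Fin (p.k + 1)))).toSphere
          {ω | p.threshold N < ‖x - s • (ω : EuclideanSpace ℝ (Fin (p.k + 1)))‖} ∧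
      (volume : Measure (EuclideanSpace ℝ (Fin (p.k + 1)))).toSphere
          {ω | p.threshold N < ‖x - s • (ω : EuclideanSpace ℝ (Fin (p.k + 1)))‖} ≤
        ENNReal.ofReal ((1 + ε) *
          (p.capFactor N * ((s - (p.threshold N - ‖x‖)) / p.unit N) ^ p.capExp)) := by
  obtain ⟨η, hη, hcap⟩ := exists_toSphere_far_bounds p.k hε
  filter_upwards [p.eventually_small_deviation hη] with N hN x s hx hs
  obtain ⟨hNpos, hτ, hdev⟩ := hN
  have hb := p.radius_pos hNpos
  have hδ := p.unit_pos hNpos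
  have hγ := p.γ_pos
  have hs' : s ∈ Set.Ioc (p.threshold N - p.cutoff N) (p.cutoff N) :=
    ⟨by linarith [hx.2, hs.1], hs.2⟩
  set h := ‖x‖ / p.radius N - 1 with hh
  set h' := s / p.radius N - 1 with hh'
  set τ := p.level N / (p.γ * N) with hτdef
  have hxh : ‖x‖ = p.radius N * (1 + h) := by rw [hh]; field_simp; ring
  have hsh : s = p.radius N * (1 + h') := by rw [hh']; field_simp; ring
  have hth : p.threshold N = p.radius N * (2 + τ) := p.threshold_eq N
  have hdiff : s - (p.threshold N - ‖x‖) = p.radius N * (h + h' - τ) := by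
    rw [hxh, hsh, hth]; ring
  have hz : 0 < h + h' - τ := by
    have : 0 < p.radius N * (h + h' - τ) := by rw [← hdiff]; linarith [hs.1]
    exact pos_of_mul_pos_right this hb.le
  have hfac : p.capFactor N * ((s - (p.threshold N - ‖x‖)) / p.unit N) ^ p.capExp =
      unitBallVolume p.k * (4 * (h + h' - τ)) ^ ((p.k : ℝ) / 2) := by
    rw [hdiff, mul_div_right_comm, p.radius_div_unit hNpos, capFactor, mul_assoc,
      ← Real.mul_rpow (by positivity) (by positivity), capExp]
    congr 2
    field_simp
  rw [hfac, hth, hsh]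
  exact hcap _ _ _ _ _ hb (hdev _ hx).1 (hdev _ hs').1 hτ hz hxh

/-- The expected number of far pairs. -/
theorem tendsto_farPairs
    (hf : f ~[Bornology.cobounded (EuclideanSpace ℝ (Fin (p.k + 1)))]
      fun x => p.c * ‖x‖ ^ p.α * Real.exp (-(p.β * ‖x‖ ^ p.γ))) (hfm : AEMeasurable f)
    [IsProbabilityMeasure (volume.withDensity fun x => ENNReal.ofReal (f x))] :
    Tendsto (fun N => Real.exp N ^ 2 *
      ((volume.withDensity fun x => ENNReal.ofReal (f x)).prod
        (volume.withDensity fun x => ENNReal.ofReal (f x))).real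
          (farPairs p.k (p.threshold N) (p.cutoff N))) atTop
      (𝓝 (unitSphereArea p.k * p.pairConst * (p.capExp * Real.Gamma (p.capExp + 1)))) := by
  set μ : Measure (EuclideanSpace ℝ (Fin (p.k + 1))) :=
    volume.withDensity fun x => ENNReal.ofReal (f x) with hμ
  set X : ℝ → ℝ := fun N => Real.exp N ^ 2 * (μ.prod μ).real
    (farPairs p.k (p.threshold N) (p.cutoff N)) with hX
  set G : ℝ → ℝ := fun N => unitSphereArea p.k * (p.pairConst / Real.log N) *
    lowerGammaIntegral p.capExp (p.range N) with hG
  have hm := p.capExp_pos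
  have hω := unitSphereArea_pos p.k
  have hGlim : Tendsto G atTop
      (𝓝 (unitSphereArea p.k * p.pairConst * (p.capExp * Real.Gamma (p.capExp + 1)))) := by
    have h1 := (tendsto_lowerGammaIntegral_div hm.le).comp p.tendsto_range
    have h2 := (p.tendsto_range_div_log.mul h1).const_mul (unitSphereArea p.k * p.pairConst)
    refine h2.congr' ?_
    filter_upwards [p.tendsto_range.eventually_gt_atTop 0] with N hN
    rw [hG, Function.comp_apply]
    field_simp
  have hsandwich : ∀ ε : ℝ, 0 < ε → ε < 1 → ∀ᶠ N in atTop,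
      (1 - ε) ^ 3 * G N ≤ X N ∧ X N ≤ (1 + ε) ^ 3 * G N := by
    intro ε hε hε1
    filter_upwards [p.eventually_density_bounds hf hε hε1.le, p.eventually_toSphere_bounds hε,
      p.tendsto_threshold_sub_cutoff.eventually_ge_atTop 0, eventually_gt_atTop 1,
      p.tendsto_range.eventually_ge_atTop 0] with N h1 h2 h3 hN hS
    have hN0 : 0 < N := by linarith
    have h := measure_farPairs_bounds (p.unit_pos hN0)
      (mul_pos (p.intensity_pos hN0) (Real.exp_pos (p.γ * N))) (p.capFactor_pos hN0)
      (Real.exp_pos N) (by linarith : 0 < 1 - ε) (by linarith : 0 < 1 + ε) h3 h1 h2 hfm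
    have hM : (p.intensity N * Real.exp (p.γ * N)) ^ 2 * p.capFactor N *
        Real.exp (-(p.threshold N / p.unit N)) = p.pairConst / Real.log N := by
      rw [← p.pairs_eq hN, p.threshold_div_unit hN0]
      have : Real.exp (-(2 * (p.γ * N) + p.level N)) * Real.exp (p.γ * N) ^ 2 =
          Real.exp (-p.level N) := by
        rw [← Real.exp_nat_mul, ← Real.exp_add]
        congr 1
        push_cast
        ring
      rw [← this]
      ring
    have hJ : 0 ≤ lowerGammaIntegral p.capExp (p.range N) := ENNReal.toReal_nonneg
    have hpc : 0 ≤ p.pairConst / Real.log N := by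
      rw [← hM]
      have := p.capFactor_pos hN0
      positivity
    rw [hM, p.range_eq hN0, ← ofReal_lowerGammaIntegral hm.le hS, ← ofReal_measureReal,
      ← ENNReal.ofReal_mul (mul_nonneg (pow_nonneg (by linarith) 3) (by positivity)),
      ← ENNReal.ofReal_mul (by positivity),
      ← ENNReal.ofReal_mul (mul_nonneg (pow_nonneg (by linarith) 3) (by positivity)),
      ENNReal.ofReal_le_ofReal_iff (by positivity),
      ENNReal.ofReal_le_ofReal_iff
        (mul_nonneg (mul_nonneg (pow_nonneg (by linarith) 3) (by positivity)) hJ)] at h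
    refine ⟨le_trans (le_of_eq ?_) h.1, h.2.trans (le_of_eq ?_)⟩ <;> rw [hG] <;> ring
  have hdiff : Tendsto (fun N => X N - G N) atTop (𝓝 0) := by
    set L := unitSphereArea p.k * p.pairConst * (p.capExp * Real.Gamma (p.capExp + 1))
    have hGbd : ∀ᶠ N in atTop, G N ≤ |L| + 1 :=
      hGlim.eventually_le_const (lt_of_le_of_lt (le_abs_self L) (lt_add_one _))
    rw [Metric.tendsto_nhds]
    intro e he
    set ε := min (1 / 2) (e / (8 * (|L| + 1))) with hεdef
    have hL : 0 < |L| + 1 := by positivity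
    have hε : 0 < ε := by positivity
    have hε1 : ε ≤ 1 / 2 := min_le_left _ _
    have hε2 : ε * (8 * (|L| + 1)) ≤ e := by
      rw [← le_div_iff₀ (by positivity)]
      exact min_le_right _ _
    filter_upwards [hsandwich ε hε (by linarith), hGbd] with N hN hNG
    rw [Real.dist_eq, sub_zero]
    have hG0 : 0 ≤ G N := by
      have h1 : (1 - ε) ^ 3 < (1 + ε) ^ 3 :=
        pow_lt_pow_left₀ (by linarith) (by linarith) three_ne_zero
      have h2 : 0 ≤ ((1 + ε) ^ 3 - (1 - ε) ^ 3) * G N := by linarith [hN.1.trans hN.2]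
      exact nonneg_of_mul_nonneg_right h2 (sub_pos.2 h1)
    have hsq : ε ^ 2 ≤ ε := by nlinarith
    have hcb : ε ^ 3 ≤ ε := by nlinarith
    have hcb0 : 0 ≤ ε ^ 3 := by positivity
    have h1 : (1 + ε) ^ 3 ≤ 1 + 7 * ε := by
      linarith [show (1 + ε) ^ 3 = 1 + 3 * ε + 3 * ε ^ 2 + ε ^ 3 by ring]
    have h2 : 1 - 7 * ε ≤ (1 - ε) ^ 3 := by
      linarith [show (1 - ε) ^ 3 = 1 - 3 * ε + 3 * ε ^ 2 - ε ^ 3 by ring, sq_nonneg ε]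
    have h3 : |X N - G N| ≤ 7 * ε * G N := by
      have h4 := hN.2.trans (mul_le_mul_of_nonneg_right h1 hG0)
      have h5 := (mul_le_mul_of_nonneg_right h2 hG0).trans hN.1
      rw [abs_le]
      constructor <;> linarith
    calc |X N - G N| ≤ 7 * ε * G N := h3
      _ ≤ 7 * ε * (|L| + 1) := by gcongr
      _ < e := by nlinarith
  have := hdiff.add hGlim
  simpa using this

/-- No point has a large expected number of far neighbours. -/
theorem exists_tendsto_slice
    (hf : f ~[Bornology.cobounded (EuclideanSpace ℝ (Fin (p.k + 1)))]
      fun x => p.c * ‖x‖ ^ p.α * Real.exp (-(p.β * ‖x‖ ^ p.γ)))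
    [IsProbabilityMeasure (volume.withDensity fun x => ENNReal.ofReal (f x))] :
    ∃ Q : ℝ → ℝ, Tendsto (fun N => Real.exp N * Q N) atTop (𝓝 0) ∧
      ∀ᶠ N in atTop, ∀ x, (volume.withDensity fun x => ENNReal.ofReal (f x)).real
        {y | (x, y) ∈ farPairs p.k (p.threshold N) (p.cutoff N)} ≤ Q N := by
  have hm := p.capExp_pos
  have hΓ : 0 < Real.Gamma (p.capExp + 1) := Real.Gamma_pos_of_pos (by linarith)
  have hpc : 0 < p.pairConst := by
    have := p.intensityConst_pos
    have := unitBallVolume_pos p.k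
    have := p.γ_pos
    unfold pairConst
    positivity
  refine ⟨fun N => Real.exp (-N) * (4 * (p.pairConst * Real.log N ^ (-(1 / 2) : ℝ) *
    Real.Gamma (p.capExp + 1))), ?_, ?_⟩
  · have h1 := (tendsto_rpow_neg_atTop (one_half_pos (α := ℝ))).comp Real.tendsto_log_atTop
    have h2 := ((h1.const_mul p.pairConst).mul_const (Real.Gamma (p.capExp + 1))).const_mul 4
    rw [mul_zero, zero_mul, mul_zero] at h2
    refine h2.congr fun N => ?_
    rw [← mul_assoc (Real.exp N), ← Real.exp_add, add_neg_cancel, Real.exp_zero, one_mul]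
    rfl
  · filter_upwards [p.eventually_density_bounds hf one_half_pos (by norm_num),
      p.eventually_toSphere_bounds one_half_pos,
      p.tendsto_threshold_sub_cutoff.eventually_ge_atTop 0, eventually_gt_atTop 1]
      with N h1 h2 h3 hN x
    have hN0 : 0 < N := by linarith
    have hl := Real.log_pos hN
    have hδ := p.unit_pos hN0
    have hD := p.intensity_pos hN0
    have hκ := p.capFactor_pos hN0
    by_cases hx : ‖x‖ ∈ Set.Ioc (p.threshold N - p.cutoff N) (p.cutoff N)
    · have h := (slice_bounds hδ (mul_pos hD (Real.exp_pos (p.γ * N))) hκ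
        (Real.exp_pos N) (by norm_num : (0 : ℝ) < 1 - 1 / 2) (by norm_num : (0 : ℝ) < 1 + 1 / 2)
        h3 h1 h2 hx).2
      have hM : p.intensity N * Real.exp (p.γ * N) * p.capFactor N *
          Real.exp (-((p.threshold N - ‖x‖) / p.unit N)) ≤
          p.pairConst * Real.log N ^ (-(1 / 2) : ℝ) := by
        have e1 : -((p.threshold N - ‖x‖) / p.unit N) ≤
            -(p.γ * N) + p.cutoffLevel N - p.level N := by
          have : (p.threshold N - p.cutoff N) / p.unit N ≤ (p.threshold N - ‖x‖) / p.unit N := by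
            gcongr
            exact hx.2
          have e : (p.threshold N - p.cutoff N) / p.unit N =
              p.γ * N - p.cutoffLevel N + p.level N := by
            rw [sub_div, p.threshold_div_unit hN0, cutoff, add_div, p.radius_div_unit hN0,
              mul_div_cancel_left₀ _ hδ.ne']
            ring
          linarith
        calc _ ≤ p.intensity N * Real.exp (p.γ * N) * p.capFactor N *
              Real.exp (-(p.γ * N) + p.cutoffLevel N - p.level N) := by gcongr
          _ = p.intensity N * p.capFactor N * Real.exp (p.cutoffLevel N) *
              Real.exp (-p.level N) := by
              have : Real.exp (p.γ * N) * Real.exp (-(p.γ * N) + p.cutoffLevel N - p.level N) =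
                  Real.exp (p.cutoffLevel N) * Real.exp (-p.level N) := by
                rw [← Real.exp_add, ← Real.exp_add]; congr 1; ring
              calc _ = p.intensity N * p.capFactor N * (Real.exp (p.γ * N) *
                    Real.exp (-(p.γ * N) + p.cutoffLevel N - p.level N)) := by ring
                _ = _ := by rw [this]; ring
          _ = (p.intensity N ^ 2 * p.capFactor N * Real.exp (-p.level N)) *
              Real.log N ^ (1 / 2 : ℝ) := by
              rw [p.exp_cutoffLevel hN]; ring
          _ = _ := by
              rw [p.pairs_eq hN, div_mul_eq_mul_div, mul_div_assoc, Real.rpow_neg hl.le]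
              congr 1
              rw [div_eq_iff hl.ne']
              have : Real.log N = Real.log N ^ (1 / 2 : ℝ) * Real.log N ^ (1 / 2 : ℝ) := by
                rw [← Real.rpow_add hl]; norm_num
              nth_rewrite 3 [this]
              have h0 : 0 < Real.log N ^ (1 / 2 : ℝ) := Real.rpow_pos_of_pos hl _
              field_simp
      have h4 : ENNReal.ofReal (Real.exp N) *
          (volume.withDensity fun x => ENNReal.ofReal (f x))
            {y | (x, y) ∈ farPairs p.k (p.threshold N) (p.cutoff N)} ≤
          ENNReal.ofReal (4 * (p.pairConst * Real.log N ^ (-(1 / 2) : ℝ) *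
            Real.Gamma (p.capExp + 1))) := by
        refine h.trans ?_
        rw [modelSlice]
        refine (mul_le_mul' le_rfl (mul_le_mul' (ENNReal.ofReal_le_ofReal hM)
          (lowerGamma_le hm.le _))).trans ?_
        have : 0 < Real.log N ^ (-(1 / 2) : ℝ) := Real.rpow_pos_of_pos hl _
        rw [← ENNReal.ofReal_mul (by positivity), ← ENNReal.ofReal_mul (by positivity)]
        refine ENNReal.ofReal_le_ofReal ?_
        gcongr
        norm_num
      rw [← ofReal_measureReal, ← ENNReal.ofReal_mul (Real.exp_pos N).le,
        ENNReal.ofReal_le_ofReal_iff (by positivity)] at h4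
      rw [Real.exp_neg, ← div_eq_inv_mul, le_div_iff₀ (Real.exp_pos N), mul_comm]
      exact h4
    · rw [slice_farPairs_eq_empty hx, measureReal_empty]
      positivity

/-- With high probability no point of the sample exceeds the truncation radius. -/
theorem tendsto_tail
    (hf : f ~[Bornology.cobounded (EuclideanSpace ℝ (Fin (p.k + 1)))]
      fun x => p.c * ‖x‖ ^ p.α * Real.exp (-(p.β * ‖x‖ ^ p.γ))) :
    Tendsto (fun N => Real.exp N * (volume.withDensity fun x => ENNReal.ofReal (f x)).real
      {x : EuclideanSpace ℝ (Fin (p.k + 1)) | p.cutoff N < ‖x‖}) atTop (𝓝 0) := by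
  obtain ⟨C, hC, htail⟩ := exists_withDensity_tail_le p.k p.c_pos p.β_pos p.γ_pos hf
  set q := p.α + p.k + 1 - p.γ with hq
  obtain ⟨η, hη, hexp⟩ := exists_abs_rpow_mul_exp_sub_one_le q p.γ one_pos
  have hγ := p.γ_pos
  have hβ := p.β_pos
  have hc := p.c_pos
  have hth : ∀ᶠ N in atTop, p.threshold N - p.cutoff N < p.cutoff N := by
    filter_upwards [p.tendsto_range.eventually_gt_atTop 0, eventually_gt_atTop 0] with N hN hN0
    rw [← p.range_eq hN0, div_pos_iff_of_pos_right (p.unit_pos hN0)] at hN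
    linarith
  have hcut : Tendsto p.cutoff atTop atTop :=
    tendsto_atTop_mono' _ (hth.mono fun N hN => hN.le) p.tendsto_threshold_sub_cutoff
  have hlim : Tendsto (fun N => C * (2 * (p.γ * p.β / p.c)) * Real.log N ^ (-(1 / 2) : ℝ)) atTop
      (𝓝 0) := by
    have h1 := (tendsto_rpow_neg_atTop (one_half_pos (α := ℝ))).comp Real.tendsto_log_atTop
    simpa using h1.const_mul (C * (2 * (p.γ * p.β / p.c)))
  refine squeeze_zero' (Eventually.of_forall fun N => by positivity) ?_ hlim
  filter_upwards [p.eventually_small_deviation hη, hth, hcut.eventually htail,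
    hcut.eventually_gt_atTop 0, eventually_gt_atTop 1] with N hN h1 h2 hcut0 hN1
  obtain ⟨hN0, -, hdev⟩ := hN
  obtain ⟨d1, d2⟩ := hdev (p.cutoff N) ⟨h1, le_rfl⟩
  have hb := p.radius_pos hN0
  have hδ := p.unit_pos hN0
  have hl := Real.log_pos hN1
  set h := p.cutoff N / p.radius N - 1 with hh
  have hBh : p.cutoff N = p.radius N * (1 + h) := by rw [hh]; field_simp; ring
  have hKh : p.γ * N * h = p.cutoffLevel N := by
    have : p.cutoff N / p.unit N = p.γ * N + p.cutoffLevel N := by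
      rw [cutoff, add_div, p.radius_div_unit hN0, mul_div_cancel_left₀ _ hδ.ne']
    rw [hBh, mul_div_right_comm, p.radius_div_unit hN0] at this
    linarith
  have h1h : 0 < 1 + h := by
    rw [hBh] at hcut0
    exact pos_of_mul_pos_right hcut0 hb.le
  have hE := hexp N h hN0.le d1 d2
  have hE2 : (1 + h) ^ q * Real.exp (-(N * ((1 + h) ^ p.γ - 1 - p.γ * h))) ≤ 2 := by
    linarith [(abs_le.1 hE).2]
  have key : Real.exp N * (p.cutoff N ^ q * Real.exp (-(p.β * p.cutoff N ^ p.γ))) =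
      (p.γ * p.β / p.c) * Real.log N ^ (-(1 / 2) : ℝ) *
        ((1 + h) ^ q * Real.exp (-(N * ((1 + h) ^ p.γ - 1 - p.γ * h)))) := by
    have e1 : p.β * p.cutoff N ^ p.γ = N * (1 + h) ^ p.γ := by
      rw [hBh, Real.mul_rpow hb.le h1h.le, ← mul_assoc, p.mul_radius_rpow hN0]
    have e2 : p.cutoff N ^ q = p.radius N ^ q * (1 + h) ^ q := by
      rw [hBh, Real.mul_rpow hb.le h1h.le]
    have e3 : Real.exp N * Real.exp (-(N * (1 + h) ^ p.γ)) =
        (Real.exp (p.cutoffLevel N))⁻¹ *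
          Real.exp (-(N * ((1 + h) ^ p.γ - 1 - p.γ * h))) := by
      rw [← Real.exp_neg, ← Real.exp_add, ← Real.exp_add, ← hKh]
      congr 1
      ring
    have e4 : p.radius N ^ q * (p.intensity N)⁻¹ = p.γ * p.β / p.c := by
      rw [intensity, unit, hq, show p.α + p.k + 1 - p.γ = (p.α + p.k) + 1 - p.γ by ring,
        Real.rpow_sub hb, Real.rpow_add_one hb.ne']
      have hb1 : 0 < p.radius N ^ (p.α + p.k) := Real.rpow_pos_of_pos hb _
      have hb2 : 0 < p.radius N ^ p.γ := Real.rpow_pos_of_pos hb _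
      have hb3 := p.mul_radius_rpow hN0
      field_simp
      linarith
    rw [e1, e2]
    calc _ = p.radius N ^ q * (1 + h) ^ q *
          (Real.exp N * Real.exp (-(N * (1 + h) ^ p.γ))) := by ring
      _ = _ := by
          rw [e3, p.exp_cutoffLevel hN1, mul_inv, ← e4, Real.rpow_neg hl.le]
          ring
  have h5 : (volume.withDensity fun x => ENNReal.ofReal (f x)).real
      {x : EuclideanSpace ℝ (Fin (p.k + 1)) | p.cutoff N < ‖x‖} ≤
      C * (p.cutoff N ^ q * Real.exp (-(p.β * p.cutoff N ^ p.γ))) := by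
    refine ENNReal.toReal_le_of_le_ofReal ?_ h2
    have : 0 ≤ p.cutoff N := by rw [hBh]; positivity
    positivity
  calc _ ≤ Real.exp N * (C * (p.cutoff N ^ q * Real.exp (-(p.β * p.cutoff N ^ p.γ)))) := by gcongr
    _ = C * (Real.exp N * (p.cutoff N ^ q * Real.exp (-(p.β * p.cutoff N ^ p.γ)))) := by ring
    _ ≤ C * ((p.γ * p.β / p.c) * Real.log N ^ (-(1 / 2) : ℝ) * 2) := by
        rw [key]
        have : 0 ≤ Real.log N ^ (-(1 / 2) : ℝ) := Real.rpow_nonneg hl.le _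
        gcongr
    _ = _ := by ring

end PairScaling

/-! ### The maximum interpoint distance and the constants -/

theorem gumbelMeasure_real_Iic (t : ℝ) :
    gumbelMeasure.real (Set.Iic t) = Real.exp (-Real.exp (-t)) := by
  have h0 : Tendsto gumbelCDF atBot (𝓝 0) :=
    Real.tendsto_exp_atBot.comp
      (tendsto_neg_atTop_atBot.comp (Real.tendsto_exp_atTop.comp tendsto_neg_atBot_atTop))
  rw [Measure.real, gumbelMeasure, StieltjesFunction.measure_Iic _ h0, sub_zero]
  exact ENNReal.toReal_ofReal (Real.exp_pos _).le

section MaxInterpointDist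

variable {E : Type*} [NormedAddCommGroup E]

theorem maxInterpointDist_le_iff {x : ℕ → E} {n : ℕ} {a : ℝ} (ha : 0 ≤ a) :
    maxInterpointDist x n ≤ a ↔ ∀ i < n, ∀ j < n, i ≠ j → ‖x i - x j‖ ≤ a := by
  rw [maxInterpointDist]
  constructor
  · intro h
    have h1 : ∀ q : {q : Fin n × Fin n // q.1 < q.2}, ‖x q.1.1 - x q.1.2‖ ≤ a := fun q =>
      (le_ciSup (Set.finite_range fun q : {q : Fin n × Fin n // q.1 < q.2} =>
        ‖x q.1.1 - x q.1.2‖).bddAbove q).trans h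
    intro i hi j hj hij
    rcases lt_or_gt_of_ne hij with hlt | hlt
    · exact h1 ⟨(⟨i, hi⟩, ⟨j, hj⟩), hlt⟩
    · rw [norm_sub_rev]
      exact h1 ⟨(⟨j, hj⟩, ⟨i, hi⟩), hlt⟩
  · intro h
    exact Real.iSup_le (fun q => h _ q.1.1.2 _ q.1.2.2 (Fin.val_ne_of_ne q.2.ne)) ha

theorem measurable_maxInterpointDist {Ω : Type*} [MeasurableSpace Ω] [MeasurableSpace E]
    [BorelSpace E] [SecondCountableTopology E] {X : ℕ → Ω → E} (hX : ∀ i, Measurable (X i))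
    (n : ℕ) : Measurable fun ω => maxInterpointDist (fun i => X i ω) n :=
  Measurable.iSup fun q => ((hX q.1.1).sub (hX q.1.2)).norm

end MaxInterpointDist

/-- Up to the event that some point lies outside the ball of radius `B`, the maximum interpoint
distance is at most `a` if and only if there are no far pairs. -/
theorem abs_measureReal_maxInterpointDist_le_sub_le {Ω : Type*} [MeasurableSpace Ω] {P : Measure Ω}
    [IsProbabilityMeasure P] {k : ℕ} {X : ℕ → Ω → EuclideanSpace ℝ (Fin (k + 1))}
    (hX : ∀ i, Measurable (X i)) {μ : Measure (EuclideanSpace ℝ (Fin (k + 1)))}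
    (hlaw : ∀ i, P.map (X i) = μ) (n : ℕ) {a B : ℝ} (ha : 0 ≤ a) :
    |P.real {ω | maxInterpointDist (fun i => X i ω) n ≤ a} -
      P.real (noPairEvent X (farPairs k a B) (Finset.range n))| ≤ n * μ.real {x | B < ‖x‖} := by
  set A : Set Ω := {ω | maxInterpointDist (fun i => X i ω) n ≤ a} with hA
  set A' := noPairEvent X (farPairs k a B) (Finset.range n) with hA'
  have h1 : A ⊆ A' := by
    intro ω hω i hi j hj hij hfar
    have := (maxInterpointDist_le_iff ha).1 hω i (Finset.mem_range.1 hi) j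
      (Finset.mem_range.1 hj) hij
    exact absurd hfar.1 (not_lt.2 this)
  have h2 : A' ⊆ A ∪ ⋃ i ∈ Finset.range n, X i ⁻¹' {x | B < ‖x‖} := by
    intro ω hω
    by_contra hcon
    simp only [Set.mem_union, Set.mem_iUnion, not_or, not_exists] at hcon
    refine hcon.1 ((maxInterpointDist_le_iff ha).2 fun i hi j hj hij => ?_)
    by_contra hlt
    exact hω i (Finset.mem_range.2 hi) j (Finset.mem_range.2 hj) hij
      ⟨not_le.1 hlt, not_lt.1 (hcon.2 i (Finset.mem_range.2 hi)),
        not_lt.1 (hcon.2 j (Finset.mem_range.2 hj))⟩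
  have hm : MeasurableSet {x : EuclideanSpace ℝ (Fin (k + 1)) | B < ‖x‖} :=
    measurableSet_lt measurable_const measurable_norm
  have h3 : P.real A ≤ P.real A' := measureReal_mono h1
  have h4 : P.real A' ≤ P.real A + n * μ.real {x | B < ‖x‖} := by
    refine (measureReal_mono h2).trans ((measureReal_union_le _ _).trans ?_)
    gcongr
    refine (measureReal_biUnion_finset_le _ _).trans (le_of_eq ?_)
    rw [Finset.sum_congr rfl fun i _ =>
      show P.real (X i ⁻¹' {x | B < ‖x‖}) = μ.real {x | B < ‖x‖} by
      rw [← hlaw i, map_measureReal_apply (hX i) hm], Finset.sum_const, nsmul_eq_mul,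
      Finset.card_range]
  rw [abs_sub_comm, abs_of_nonneg (by linarith)]
  linarith

theorem unitBallVolume_eq {k : ℕ} (hk : 0 < k) :
    unitBallVolume k = Real.pi ^ ((k : ℝ) / 2) / Real.Gamma ((k : ℝ) / 2 + 1) := by
  have : Nonempty (Fin k) := ⟨⟨0, hk⟩⟩
  rw [unitBallVolume, Measure.real, EuclideanSpace.volume_ball]
  have hΓ : 0 < Real.Gamma ((k : ℝ) / 2 + 1) := Real.Gamma_pos_of_pos (by positivity)
  simp only [ENNReal.ofReal_one, one_pow, one_mul, Fintype.card_fin]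
  rw [ENNReal.toReal_ofReal (by positivity), ← Real.rpow_natCast, Real.sqrt_eq_rpow,
    ← Real.rpow_mul Real.pi_pos.le]
  congr 2
  ring

theorem unitSphereArea_eq (k : ℕ) :
    unitSphereArea k = 2 * Real.pi ^ (((k : ℝ) + 1) / 2) / Real.Gamma (((k : ℝ) + 1) / 2) := by
  have h := unitBallVolume_eq (Nat.succ_pos k)
  rw [unitBallVolume] at h
  rw [unitSphereArea, Measure.toSphere_real_apply_univ, finrank_euclideanSpace_fin, h]
  push_cast
  have hk : 0 < ((k : ℝ) + 1) / 2 := by positivity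
  rw [Real.Gamma_add_one hk.ne']
  have := Real.Gamma_pos_of_pos hk
  field_simp

namespace PairScaling

/-- The constant `c'_d` of the centring makes the expected number of far pairs asymptotic to
`e^{-t}`. -/
theorem unitSphereArea_mul_pairConst (p : PairScaling) (t : ℝ)
    (hC : p.C = Real.log (interpointConst (p.k + 1) * p.β ^ (-(2 * ((p.α + (p.k + 1 : ℕ))) / p.γ)) *
      p.γ ^ (-((((p.k + 1 : ℕ) : ℝ) + 3) / 2)) * p.c ^ 2) + t) :
    unitSphereArea p.k * p.pairConst * (p.capExp * Real.Gamma (p.capExp + 1)) =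
      2 * Real.exp (-t) := by
  have hk : (0 : ℝ) < p.k := by exact_mod_cast p.k_pos
  have hβ := p.β_pos
  have hγ := p.γ_pos
  have hc := p.c_pos
  have hπ := Real.pi_pos
  have hΓ1 : 0 < Real.Gamma (((p.k : ℝ) + 1) / 2) := Real.Gamma_pos_of_pos (by positivity)
  have hΓ2 : 0 < Real.Gamma ((p.k : ℝ) / 2 + 1) := Real.Gamma_pos_of_pos (by positivity)
  have hIC : interpointConst (p.k + 1) = p.k * (2 : ℝ) ^ ((p.k : ℝ) - 1) *
      Real.pi ^ ((p.k : ℝ) + 1 / 2) / Real.Gamma (((p.k : ℝ) + 1) / 2) := by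
    rw [interpointConst]
    push_cast
    congr 3 <;> ring_nf
  have hpos : 0 < interpointConst (p.k + 1) * p.β ^ (-(2 * ((p.α + (p.k + 1 : ℕ))) / p.γ)) *
      p.γ ^ (-((((p.k + 1 : ℕ) : ℝ) + 3) / 2)) * p.c ^ 2 := by
    rw [hIC]
    positivity
  have e1 : p.intensityConst ^ 2 = p.c ^ 2 * p.γ ^ (-2 : ℝ) *
      p.β ^ (-(2 * ((p.α + (p.k + 1 : ℕ))) / p.γ)) := by
    rw [intensityConst, mul_pow, mul_pow, ← Real.rpow_natCast (p.β ^ _), ← Real.rpow_mul hβ.le,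
      Real.rpow_neg hγ.le, Real.rpow_two, inv_pow]
    congr 2
    push_cast
    ring
  have e2 : (4 / p.γ) ^ p.capExp = 2 * (2 : ℝ) ^ ((p.k : ℝ) - 1) * p.γ ^ (-((p.k : ℝ) / 2)) := by
    rw [capExp, Real.div_rpow (by norm_num) hγ.le, Real.rpow_neg hγ.le, ← div_eq_mul_inv]
    congr 1
    rw [show (4 : ℝ) = 2 ^ (2 : ℝ) by norm_num, ← Real.rpow_mul (by norm_num),
      Real.rpow_sub_one (by norm_num)]
    rw [show 2 * ((p.k : ℝ) / 2) = p.k by ring]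
    ring
  have e3 : p.γ ^ (-((((p.k + 1 : ℕ) : ℝ) + 3) / 2)) =
      p.γ ^ (-2 : ℝ) * p.γ ^ (-((p.k : ℝ) / 2)) := by
    rw [← Real.rpow_add hγ]
    congr 1
    push_cast
    ring
  have e4 : Real.pi ^ ((p.k : ℝ) + 1 / 2) =
      Real.pi ^ (((p.k : ℝ) + 1) / 2) * Real.pi ^ ((p.k : ℝ) / 2) := by
    rw [← Real.rpow_add hπ]
    congr 1
    ring
  rw [pairConst, hC, neg_add, Real.exp_add, Real.exp_neg (Real.log _), Real.exp_log hpos,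
    unitSphereArea_eq, unitBallVolume_eq p.k_pos, e1, e2, e3, hIC, e4, capExp]
  have h1 : 0 < Real.pi ^ (((p.k : ℝ) + 1) / 2) := Real.rpow_pos_of_pos hπ _
  have h2 : 0 < Real.pi ^ ((p.k : ℝ) / 2) := Real.rpow_pos_of_pos hπ _
  have h3 : 0 < (2 : ℝ) ^ ((p.k : ℝ) - 1) := Real.rpow_pos_of_pos two_pos _
  have h4 : 0 < p.γ ^ (-((p.k : ℝ) / 2)) := Real.rpow_pos_of_pos hγ _
  have h5 : 0 < p.γ ^ (-2 : ℝ) := Real.rpow_pos_of_pos hγ _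
  have h6 : 0 < p.β ^ (-(2 * ((p.α + (p.k + 1 : ℕ))) / p.γ)) := Real.rpow_pos_of_pos hβ _
  generalize Real.pi ^ (((p.k : ℝ) + 1) / 2) = a1 at *
  generalize Real.pi ^ ((p.k : ℝ) / 2) = a2 at *
  generalize (2 : ℝ) ^ ((p.k : ℝ) - 1) = a3 at *
  generalize p.γ ^ (-((p.k : ℝ) / 2)) = a4 at *
  generalize p.γ ^ (-2 : ℝ) = a5 at *
  generalize p.β ^ (-(2 * ((p.α + (p.k + 1 : ℕ))) / p.γ)) = a6 at *
  field_simp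

theorem interpointScale_eq (p : PairScaling) {n : ℕ} (hn : 0 < Real.log n) :
    interpointScale p.β p.γ n = (p.unit (Real.log n))⁻¹ := by
  have hβ := p.β_pos
  have hγ := p.γ_pos
  rw [interpointScale, unit, radius, inv_div, Real.div_rpow hn.le hβ.le, Real.rpow_sub hn,
    Real.rpow_one]
  have := Real.rpow_pos_of_pos hn (1 / p.γ)
  have := Real.rpow_pos_of_pos hβ (1 / p.γ)
  field_simp

end PairScaling

/-! ### The limit law -/

theorem theorem3 {Ω Ω' : Type*} [MeasurableSpace Ω] [MeasurableSpace Ω']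
    (P : Measure Ω) [IsProbabilityMeasure P] (P' : Measure Ω') [IsProbabilityMeasure P']
    (d : ℕ) (hd : 2 ≤ d)
    (X : ℕ → Ω → EuclideanSpace ℝ (Fin d))
    (hX_meas : ∀ i, Measurable (X i))
    (hX_indep : iIndepFun X P)
    (hX_ident : ∀ i, IdentDistrib (X i) (X 0) P P)
    (hX_symm : IsSphericallySymmetric (P.map (X 0)))
    (f : EuclideanSpace ℝ (Fin d) → ℝ)
    (hf_meas : AEMeasurable f volume) (hf_nonneg : ∀ x, 0 ≤ f x)
    (hX_density : P.map (X 0) = volume.withDensity (fun x => ENNReal.ofReal (f x)))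
    (c α β γ : ℝ) (hc : 0 < c) (hβ : 0 < β) (hγ : 0 < γ)
    (hf : f ~[Bornology.cobounded (EuclideanSpace ℝ (Fin d))]
      fun x => c * ‖x‖ ^ α * Real.exp (-(β * ‖x‖ ^ γ)))
    (V : Ω' → ℝ) (hV : HasLaw V gumbelMeasure P') :
    TendstoInDistribution
      (fun (n : ℕ) (ω : Ω) =>
        interpointScale β γ n * maxInterpointDist (fun i => X i ω) n
          - interpointCentring d c α β γ n)
      atTop V (fun _ => P) P' := by
  obtain ⟨k, rfl⟩ : ∃ k, d = k + 1 := ⟨d - 1, by omega⟩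
  refine tendstoInDistribution_of_tendsto_measureReal_le
    (fun n => ((measurable_maxInterpointDist hX_meas n).const_mul _).sub_const _)
    hV.aemeasurable fun t => ?_
  rw [hV.map_eq, gumbelMeasure_real_Iic]
  set μ : Measure (EuclideanSpace ℝ (Fin (k + 1))) :=
    volume.withDensity fun x => ENNReal.ofReal (f x) with hμ
  have hlaw : ∀ i, P.map (X i) = μ := fun i => (hX_ident i).map_eq.trans hX_density
  have hprob : IsProbabilityMeasure μ := by
    rw [← hlaw 0]
    exact Measure.isProbabilityMeasure_map (hX_meas 0).aemeasurable
  let p : PairScaling :=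
    { k := k, c := c, α := α, β := β, γ := γ,
      C := Real.log (interpointConst (k + 1) * β ^ (-(2 * (α + (k + 1 : ℕ)) / γ)) *
        γ ^ (-((((k + 1 : ℕ) : ℝ) + 3) / 2)) * c ^ 2) + t
      k_pos := by omega
      c_pos := hc
      β_pos := hβ
      γ_pos := hγ }
  have hlog : Tendsto (fun n : ℕ => Real.log n) atTop atTop :=
    Real.tendsto_log_atTop.comp tendsto_natCast_atTop_atTop
  have hexp : ∀ᶠ n : ℕ in atTop, Real.exp (Real.log n) = n := by
    filter_upwards [eventually_gt_atTop 0] with n hn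
    exact Real.exp_log (by exact_mod_cast hn)
  have hthr : Tendsto p.threshold atTop atTop := by
    have h1 : Tendsto (fun N => p.threshold N - p.cutoff N) atTop atTop :=
      p.tendsto_threshold_sub_cutoff
    refine tendsto_atTop_mono' _ ?_ h1
    filter_upwards [p.tendsto_range.eventually_ge_atTop 0, eventually_gt_atTop 0,
      h1.eventually_ge_atTop 0] with N h2 h3 h4
    rw [← p.range_eq h3] at h2
    have h5 : 0 ≤ 2 * p.cutoff N - p.threshold N := by
      by_contra hcon
      exact absurd h2 (not_le.2 (div_neg_of_neg_of_pos (not_le.1 hcon) (p.unit_pos h3)))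
    linarith
  -- the Poisson limit for the number of far pairs inside the truncation radius
  obtain ⟨Q, hQ0, hQ⟩ := p.exists_tendsto_slice hf
  have hpairs := p.tendsto_farPairs hf hf_meas
  rw [p.unitSphereArea_mul_pairConst t rfl] at hpairs
  have hpoisson : Tendsto (fun n : ℕ => P.real (noPairEvent X
      (farPairs k (p.threshold (Real.log n)) (p.cutoff (Real.log n))) (Finset.range n))) atTop
      (𝓝 (Real.exp (-Real.exp (-t)))) := by
    refine tendsto_measureReal_noPairEvent hX_meas hX_indep hlaw (Q := fun n => Q (Real.log n))
      (fun n => measurableSet_farPairs _ _ _) (fun n => farPairs_symm) (hlog.eventually hQ) ?_ ?_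
    · refine (hQ0.comp hlog).congr' ?_
      filter_upwards [hexp] with n hn
      rw [Function.comp_apply, hn]
    · refine (hpairs.comp hlog).congr' ?_
      filter_upwards [hexp] with n hn
      rw [Function.comp_apply, hn]
  -- the truncation is negligible
  have hdiff : Tendsto (fun n : ℕ => P.real {ω | maxInterpointDist (fun i => X i ω) n ≤
      p.threshold (Real.log n)} - P.real (noPairEvent X
      (farPairs k (p.threshold (Real.log n)) (p.cutoff (Real.log n))) (Finset.range n))) atTop
      (𝓝 0) := by
    refine squeeze_zero_norm' ?_ ((p.tendsto_tail hf).comp hlog)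
    filter_upwards [hexp, (hthr.comp hlog).eventually_ge_atTop 0] with n hn hn0
    rw [Function.comp_apply, hn]
    exact abs_measureReal_maxInterpointDist_le_sub_le hX_meas hlaw n hn0
  have hlim := hdiff.add hpoisson
  simp only [sub_add_cancel, zero_add] at hlim
  refine hlim.congr' ?_
  filter_upwards [hlog.eventually_gt_atTop 0] with n hn
  have hδ := p.unit_pos hn
  have hscale : interpointScale β γ n = (p.unit (Real.log n))⁻¹ := p.interpointScale_eq hn
  have hcentring : interpointCentring (k + 1) c α β γ n + t =
      p.threshold (Real.log n) / p.unit (Real.log n) := by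
    rw [p.threshold_div_unit hn, interpointCentring]
    change _ = 2 * (γ * Real.log n) + ((2 * ((α + k + 1) / γ) - ((k : ℝ) + 4) / 2) *
      Real.log (Real.log n) + Real.log (Real.log (Real.log n)) +
      (Real.log (interpointConst (k + 1) * β ^ (-(2 * (α + (k + 1 : ℕ)) / γ)) *
        γ ^ (-((((k + 1 : ℕ) : ℝ) + 3) / 2)) * c ^ 2) + t))
    generalize Real.log (interpointConst (k + 1) * β ^ (-(2 * (α + (k + 1 : ℕ)) / γ)) *
      γ ^ (-((((k + 1 : ℕ) : ℝ) + 3) / 2)) * c ^ 2) = Z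
    push_cast
    ring
  congr 1
  ext ω
  rw [Set.mem_ofPred_eq, Set.mem_ofPred_eq, hscale, sub_le_iff_le_add', hcentring,
    ← div_eq_inv_mul, div_le_div_iff_of_pos_right hδ]
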